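/- Conventions. $\log$ is the natural logarithm. For $1\le r\le n$ let $V_r=\{v\in\mathbb R^n:\|v\|_2=1,\ \|v\|_0\le r\}$, let $$\rho=10\log_2 e\cdot\max\Big\{1,\frac{\log(er)}{\log(en/r)}\Big\},$$ and let $s_1$ be the least integer with $2^{s_1}\ge\rho\, r\log(en/r)$. An orthogonal (or, over $\mathbb C$, unitary) $n\times n$ matrix is of Hadamard type with constant $\beta\ge1$ if all its entries have absolute value at most $\beta/\sqrt n$. For such matrices $U,W,O$ and $v\in\mathbb R^n$ put $\Gamma_v=\sqrt n\,U D_{Wv}O$, where $D_x$ is the diagonal matrix with diagonal $x$. The random vector $\xi=(\xi_i)_{i=1}^n$ has independent coordinates of mean zero and variance one that are $L$-subgaussian: $(\mathbb E|\xi_i|^p)^{1/p}\le L\sqrt p$ for all $p\ge1$. Theorem. Fix the scalar field ($\mathbb R$ or $\mathbb C$), $L\ge1$ and $\beta\ge1$. (i) There are constants $\kappa_1,\kappa_2>0$, depending only on $L$ and $\beta$, such that for all $1\le r\le n$, all $U,W,O$ of Hadamard type with constant $\beta$, all $\xi$ as above and all $v\in V_r$, $$\Pr\big(\|\Gamma_v\xi\|_2\le\kappa_1\sqrt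 n\,\|v\|_2\big)\le\Big(\frac12\Big)^{\kappa_2 n/r}.\qquad(*)$$ (ii) For any $\kappa_1,\kappa_2>0$ for which $(*)$ always holds there are constants $c_1,c_2>0$, depending only on $L$, $\beta$ (and on the choice of $\kappa_1,\kappa_2$), such that the following holds. Let $1\le r\le n$ with $r\log^4 n\le c_1 n$, let $U,W,O$ and $\xi$ be as above, and let $V_{r,s_1}\subset V_r$ be any set with at most $2^{2^{s_1}}$ elements (for instance a maximal $\varepsilon$-separated subset of $V_r$ of at most that cardinality). Then with probability at least $1-2\exp(-c_2 n/r)$, $$\inf_{v\in V_{r,s_1}}\|\Gamma_v\xi\|_2\ \ge\ \frac{\kappa_1}{2}\sqrt n .$$ No relation between $n/r$ and $2^{s_1}$ is assumed; in particular the high-sparsity case, in which $2^{s_1}$ is at least a constant (depending on $L$ and $\beta$) times $n/r$, is included. -/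

import Mathlib

open MeasureTheory ProbabilityTheory

universe u w

/-- `‖v‖₀ ≤ r` and `‖v‖₂ = 1`: the `r`-sparse vectors in the Euclidean unit sphere of `ℝⁿ`. -/
def sparseSphere (n r : ℕ) : Set (EuclideanSpace ℝ (Fin n)) :=
  {v | ‖v‖ = 1 ∧ (Finset.univ.filter fun i => v i ≠ 0).card ≤ r}

/-- Matrices of Hadamard type with constant `β`: orthogonal (for `𝕜 = ℝ`) or unitary
(for `𝕜 = ℂ`, as needed for the Fourier matrix) with all entries at most `β / √n`. -/
def IsHadamardType {𝕜 : Type w} [RCLike 𝕜] {n : ℕ} (β : ℝ) (M : Matrix (Fin n) (Fin n) 𝕜) : Prop :=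
  M ∈ Matrix.unitaryGroup (Fin n) 𝕜 ∧ ∀ i j, ‖M i j‖ ≤ β / √(n : ℝ)

/-- `Γ_v = √n U D_{Wv} O`, where `D_x` is the diagonal matrix with diagonal `x`. -/
noncomputable def gammaMatrix {𝕜 : Type w} [RCLike 𝕜] {n : ℕ} (U W O : Matrix (Fin n) (Fin n) 𝕜)
    (v : EuclideanSpace ℝ (Fin n)) : Matrix (Fin n) (Fin n) 𝕜 :=
  ((√(n : ℝ) : ℝ) : 𝕜) • (U * Matrix.diagonal (W.mulVec fun i => ((v i : ℝ) : 𝕜)) * O)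

/-- The Euclidean norm `‖M x‖₂` of the image of a real vector `x`. -/
noncomputable def normMulVec {𝕜 : Type w} [RCLike 𝕜] {n : ℕ} (M : Matrix (Fin n) (Fin n) 𝕜)
    (x : Fin n → ℝ) : ℝ :=
  ‖(WithLp.toLp 2 (M.mulVec fun i => ((x i : ℝ) : 𝕜)) : EuclideanSpace 𝕜 (Fin n))‖

/-- Independent, mean-zero, variance one coordinates with
`(𝔼 |ξ_i|^p)^{1/p} ≤ L √p` for all real `p ≥ 1`. -/
structure IsSubgaussianGenerator {Ω : Type u} [MeasurableSpace Ω] (μ : Measure Ω) {n : ℕ} (L : ℝ)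
    (ξ : Fin n → Ω → ℝ) : Prop where
  measurable : ∀ i, Measurable (ξ i)
  indep : iIndepFun ξ μ
  mean_zero : ∀ i, ∫ ω, ξ i ω ∂μ = 0
  variance_one : ∀ i, variance (ξ i) μ = 1
  moments : ∀ i, ∀ p : ℝ, 1 ≤ p →
    eLpNorm (ξ i) (ENNReal.ofReal p) μ ≤ ENNReal.ofReal (L * √p)

/-- `κ₁, κ₂` are constants of the individual small ball estimate
`Pr(‖Γ_v ξ‖₂ ≤ κ₁ √n ‖v‖₂) ≤ (1/2)^{κ₂ n / r}`, valid for every `v ∈ V_r`, uniformly in the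
dimension, the sparsity, the matrices and the generator. -/
def IsSmallBallPair (𝕜 : Type w) [RCLike 𝕜] (L β κ₁ κ₂ : ℝ) : Prop :=
  0 < κ₁ ∧ 0 < κ₂ ∧
  ∀ (n r : ℕ), 1 ≤ r → r ≤ n →
  ∀ (U W O : Matrix (Fin n) (Fin n) 𝕜),
    IsHadamardType β U → IsHadamardType β W → IsHadamardType β O →
  ∀ (Ω : Type u) [MeasurableSpace Ω] (μ : Measure Ω) [IsProbabilityMeasure μ]
    (ξ : Fin n → Ω → ℝ), IsSubgaussianGenerator μ L ξ →
  ∀ v ∈ sparseSphere n r,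
    μ.real {ω | normMulVec (gammaMatrix U W O v) (fun i => ξ i ω) ≤ κ₁ * √(n : ℝ) * ‖v‖}
      ≤ (1 / 2 : ℝ) ^ (κ₂ * n / r)

/-- `ρ = 10 log₂ e · max {1, log (e r) / log (e n / r)}`. -/
noncomputable def rho (n r : ℕ) : ℝ :=
  10 * Real.logb 2 (Real.exp 1) *
    max 1 (Real.log (Real.exp 1 * r) / Real.log (Real.exp 1 * n / r))

/-- The level `s₁` with `2 ^ s₁ = ρ r log (e n / r)`, rounded up to an integer. -/
noncomputable def sOne (n r : ℕ) : ℕ :=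
  ⌈Real.logb 2 (rho n r * r * Real.log (Real.exp 1 * n / r))⌉₊

/-- `A` can be the `s`-th set of an admissible sequence of `T`: `A ⊆ T` and `|A| ≤ 2 ^ (2 ^ s)`. -/
def IsAdmissibleLevel {E : Type w} (T : Set E) (s : ℕ) (A : Finset E) : Prop :=
  (A : Set E) ⊆ T ∧ A.card ≤ 2 ^ (2 ^ s)

/-!
Write `X_v = ∑ᵢ |(W v)ᵢ|² |(O ξ)ᵢ|²`. Since `U` is unitary, `‖Γ_v ξ‖² = n X_v`, and `𝔼 X_v = 1` for
unit vectors `v`. Both parts are lower bounds for the quadratic form `X_v` in `ξ`; its diagonal part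
is `Z_v = ∑ₖ aₖ ξₖ²`, where the `aₖ` have sum one and are at most `β² / n`, so that `Z_v`
concentrates with exponent `n`.

The off-diagonal part is controlled by a self-normalised inequality, `expMoment_offDiag_le_one`: for a
matrix `N` with zero diagonal and every real `t`,
`𝔼 exp (t ⟨ξ, N ξ⟩ - C t² (‖N ξ‖² + ∑ Nⱼₖ² ξₖ²)) ≤ 1`.
It follows from Jensen's inequality, as `⟨ξ, N ξ⟩` is four times the average of its decoupled versions
over the subsets of the coordinates. For the form with weights `d` the compensator is bounded by the
forms with weights `d²` (`expMoment_weightedForm_sub_le_one`).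

Small ball estimate. For `d = |W v|²` one has `d² ≤ (β² r / n) d`, so the compensator is a small multiple
of `X_v + Z_v` as long as `t` is at most a small multiple of `n / r`; this yields
`IsSubgaussianGenerator.measureReal_weightedForm_le`.

Uniform estimate. For two points `u, v` at distance `δ` in the norm `‖W ·‖_∞` the weights
`d = |W u|² - |W v|²` satisfy `d² ≤ 2 δ² (|W u|² + |W v|²)`. Hence, up to probability `2 exp (-s)`, the
increment of `X - Z` is at most a multiple of `√s δ (1 + max X + max Z)`, for every `s`. Maurey's
empirical method (`exists_netCenter_near`) provides `(2 n) ^ m` points within distance of order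
`√(r / n) √(log n / m)`, so each of the about `log n` levels `m = m₀ 2 ^ k` of a chain contributes
`√(r / n) log n`, and the sum is small if `r log⁴ n` is small compared with `n`. The first level has at
most `exp (c n / r)` points; the last is the set itself, of cardinality `exp (O (r log n))`. The
resulting inequality bounds `max X` in terms of itself with a small coefficient (`le_of_chain`), so
`X_v ≥ 5 / 8` for all `v` in the set. This suffices because the hypothesis on `κ₁` together with
`𝔼 X_v = 1` forces `κ₁² ≤ 5 / 2` (`IsSmallBallPair.sq_le`) unless `n / r` is bounded, in which case the
claimed probability is at most zero.
-/

open scoped ENNReal NNReal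

/-! ### Exponential moments and one-dimensional estimates -/

/-- The exponential moment `𝔼 exp f`, as an extended nonnegative real, so that no integrability
has to be tracked. -/
noncomputable def expMoment {Ω : Type u} [MeasurableSpace Ω] (μ : Measure Ω) (f : Ω → ℝ) : ℝ≥0∞ :=
  ∫⁻ ω, ENNReal.ofReal (Real.exp (f ω)) ∂μ

lemma expMoment_mono {Ω : Type u} [MeasurableSpace Ω] {μ : Measure Ω} {f g : Ω → ℝ}
    (h : ∀ ω, f ω ≤ g ω) : expMoment μ f ≤ expMoment μ g :=
  lintegral_mono fun ω => ENNReal.ofReal_le_ofReal (Real.exp_le_exp.2 (h ω))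

lemma expMoment_const_add {Ω : Type u} [MeasurableSpace Ω] {μ : Measure Ω} (f : Ω → ℝ) (c : ℝ) :
    expMoment μ (fun ω => c + f ω) = ENNReal.ofReal (Real.exp c) * expMoment μ f := by
  unfold expMoment
  rw [← lintegral_const_mul' _ _ ENNReal.ofReal_ne_top]
  simp_rw [Real.exp_add, ENNReal.ofReal_mul (Real.exp_pos c).le]

lemma measureReal_le_of_expMoment_le {Ω : Type u} [MeasurableSpace Ω] {μ : Measure Ω}
    {f : Ω → ℝ} (hf : Measurable f) {c t : ℝ}
    (h : expMoment μ f ≤ ENNReal.ofReal (Real.exp c)) :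
    μ.real {ω | t ≤ f ω} ≤ Real.exp (c - t) := by
  have h1 := mul_meas_ge_le_lintegral (μ := μ) (f := fun ω => ENNReal.ofReal (Real.exp (f ω)))
    (by fun_prop) (ENNReal.ofReal (Real.exp t))
  have h2 : {ω | ENNReal.ofReal (Real.exp t) ≤ ENNReal.ofReal (Real.exp (f ω))}
      = {ω | t ≤ f ω} := by
    ext ω
    simp [ENNReal.ofReal_le_ofReal_iff (Real.exp_pos _).le]
  rw [h2] at h1
  have h3 : μ {ω | t ≤ f ω} ≤ ENNReal.ofReal (Real.exp (c - t)) := by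
    rw [Real.exp_sub, ENNReal.ofReal_div_of_pos (Real.exp_pos t),
      ENNReal.le_div_iff_mul_le (Or.inl (by simp [Real.exp_pos])) (Or.inl ENNReal.ofReal_ne_top),
      mul_comm]
    exact h1.trans h
  exact ENNReal.toReal_le_of_le_ofReal (Real.exp_pos _).le h3

/-- The exponential moments of the square: expanding the exponential, `𝔼 ξ ^ (2p) ≤ (2 p L²) ^ p`
and `p ^ p ≤ e ^ p p!` turn the moment condition into a geometric series. -/
lemma expMoment_sq_le_two {Ω : Type u} [MeasurableSpace Ω] {μ : Measure Ω} [IsProbabilityMeasure μ]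
    {L : ℝ} (hL : 1 ≤ L) {X : Ω → ℝ} (hX : Measurable X)
    (hm : ∀ p : ℝ, 1 ≤ p → eLpNorm X (ENNReal.ofReal p) μ ≤ ENNReal.ofReal (L * √p)) :
    expMoment μ (fun ω => 1 / (4 * Real.exp 1 * L ^ 2) * X ω ^ 2) ≤ 2 := by
  set a : ℝ := 1 / (4 * Real.exp 1 * L ^ 2) with ha
  have ha0 : 0 < a := by positivity
  have hexp : ∀ y : ℝ, 0 ≤ y → ENNReal.ofReal (Real.exp y)
      = ∑' p : ℕ, ENNReal.ofReal (y ^ p / p.factorial) := by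
    intro y hy
    rw [← ENNReal.ofReal_tsum_of_nonneg (fun p => by positivity) (Real.summable_pow_div_factorial y),
      Real.exp_eq_exp_ℝ, NormedSpace.exp_eq_tsum_div]
  have hterm : ∀ p : ℕ, ∫⁻ ω, ENNReal.ofReal ((a * X ω ^ 2) ^ p / p.factorial) ∂μ
      ≤ (2⁻¹ : ℝ≥0∞) ^ p := by
    intro p
    rcases Nat.eq_zero_or_pos p with rfl | hp
    · simp
    have hq : (1 : ℝ) ≤ (2 * p : ℕ) := by exact_mod_cast (by omega : 1 ≤ 2 * p)
    have h1 := hm ((2 * p : ℕ) : ℝ) hq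
    rw [eLpNorm_eq_lintegral_rpow_enorm_toReal (by simp; omega) ENNReal.ofReal_ne_top,
      ENNReal.toReal_ofReal (by linarith), one_div,
      ENNReal.rpow_inv_le_iff (by linarith)] at h1
    simp only [ENNReal.rpow_natCast] at h1
    have h2 : ∀ ω, ENNReal.ofReal ((a * X ω ^ 2) ^ p / p.factorial)
        = ENNReal.ofReal (a ^ p / p.factorial) * ‖X ω‖ₑ ^ (2 * p) := by
      intro ω
      rw [Real.enorm_eq_ofReal_abs, ← ENNReal.ofReal_pow (abs_nonneg _),
        ← ENNReal.ofReal_mul (by positivity), pow_mul |X ω|, sq_abs]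
      congr 1
      rw [mul_pow]; ring
    simp_rw [h2]
    rw [lintegral_const_mul' _ _ ENNReal.ofReal_ne_top]
    refine (mul_le_mul_right h1 _).trans ?_
    rw [← ENNReal.ofReal_pow (by positivity), ← ENNReal.ofReal_mul (by positivity)]
    have h3 : (2⁻¹ : ℝ≥0∞) ^ p = ENNReal.ofReal ((1 / 2) ^ p) := by
      rw [ENNReal.ofReal_pow (by norm_num)]; congr 1
      rw [one_div, ENNReal.ofReal_inv_of_pos (by norm_num)]; simp
    rw [h3]
    apply ENNReal.ofReal_le_ofReal
    have h4 : (p : ℝ) ^ p / p.factorial ≤ Real.exp 1 ^ p := by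
      rw [← Real.exp_nat_mul, mul_one]
      exact Real.pow_div_factorial_le_exp _ (by positivity) p
    calc a ^ p / p.factorial * (L * √((2 * p : ℕ) : ℝ)) ^ (2 * p)
        = a ^ p / p.factorial * (L ^ 2 * (2 * p)) ^ p := by
          rw [pow_mul, mul_pow L, Real.sq_sqrt (by positivity)]; push_cast; ring
      _ = (2 * a * L ^ 2) ^ p * ((p : ℝ) ^ p / p.factorial) := by
          rw [mul_pow, mul_pow, mul_pow, mul_pow]; ring
      _ ≤ (2 * a * L ^ 2) ^ p * Real.exp 1 ^ p := by gcongr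
      _ = (1 / 2) ^ p := by
          rw [← mul_pow, ha]
          congr 1
          have : Real.exp 1 ≠ 0 := (Real.exp_pos 1).ne'
          field_simp
          norm_num
  calc expMoment μ (fun ω => a * X ω ^ 2)
      = ∫⁻ ω, ∑' p : ℕ, ENNReal.ofReal ((a * X ω ^ 2) ^ p / p.factorial) ∂μ :=
        lintegral_congr fun ω => hexp _ (by positivity)
    _ = ∑' p : ℕ, ∫⁻ ω, ENNReal.ofReal ((a * X ω ^ 2) ^ p / p.factorial) ∂μ :=
        lintegral_tsum fun p => by fun_prop
    _ ≤ ∑' p : ℕ, (2⁻¹ : ℝ≥0∞) ^ p := ENNReal.tsum_le_tsum hterm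
    _ = 2 := by rw [ENNReal.tsum_geometric]; simp

lemma integrable_exp_sq_of_expMoment_le {Ω : Type u} [MeasurableSpace Ω] {μ : Measure Ω} {a : ℝ}
    {X : Ω → ℝ} (hX : Measurable X)
    (h : expMoment μ (fun ω => a * X ω ^ 2) ≤ 2) :
    Integrable (fun ω => Real.exp (a * X ω ^ 2)) μ := by
  refine ⟨by fun_prop, ?_⟩
  rw [hasFiniteIntegral_iff_ofReal (Filter.Eventually.of_forall fun ω => (Real.exp_pos _).le)]
  exact h.trans_lt (by simp)

lemma integral_exp_sq_le_two {Ω : Type u} [MeasurableSpace Ω] {μ : Measure Ω} {a : ℝ}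
    {X : Ω → ℝ} (hX : Measurable X)
    (h : expMoment μ (fun ω => a * X ω ^ 2) ≤ 2) :
    ∫ ω, Real.exp (a * X ω ^ 2) ∂μ ≤ 2 := by
  rw [integral_eq_lintegral_of_nonneg_ae
    (Filter.Eventually.of_forall fun ω => (Real.exp_pos _).le) (by fun_prop)]
  exact ENNReal.toReal_le_of_le_ofReal (by norm_num) (by simpa [expMoment] using h)

section OneDim

variable {Ω : Type u} [MeasurableSpace Ω] {μ : Measure Ω} [IsProbabilityMeasure μ]
  {a : ℝ} {X : Ω → ℝ}

/-- `e ^ {s y} ≤ 1 + s (e ^ y - 1)` for `0 ≤ s ≤ 1`, by convexity. -/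
lemma exp_mul_le_chord {s y : ℝ} (hs : 0 ≤ s) (hs1 : s ≤ 1) :
    Real.exp (s * y) ≤ 1 + s * (Real.exp y - 1) := by
  have h := convexOn_exp.2 (Set.mem_univ (0 : ℝ)) (Set.mem_univ y) (sub_nonneg.2 hs1) hs
    (by ring)
  simp only [smul_eq_mul, mul_zero, zero_add, Real.exp_zero, mul_one] at h
  linarith

lemma exp_le_add_exp_sq (x : ℝ) : Real.exp x ≤ x + Real.exp (x ^ 2) := by
  have h2 := Real.add_one_le_exp (x ^ 2)
  rcases le_or_gt |x| 1 with h | h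
  · have h1 := (abs_le.1 (Real.abs_exp_sub_one_sub_id_le h)).2
    linarith
  · rcases lt_abs.1 h with h | h
    · have : Real.exp x ≤ Real.exp (x ^ 2) := Real.exp_le_exp.2 (by nlinarith)
      linarith
    · have : Real.exp x ≤ 1 := Real.exp_le_one_iff.2 (by linarith)
      nlinarith

/-- A centred variable with `𝔼 exp (a X²) ≤ 2` is subgaussian. -/
lemma hasSubgaussianMGF_of_expMoment_sq (ha : 0 < a) (hX : Measurable X)
    (h0 : ∫ ω, X ω ∂μ = 0) (h : expMoment μ (fun ω => a * X ω ^ 2) ≤ 2) :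
    HasSubgaussianMGF X (Real.toNNReal (2 / a)) μ := by
  have hI := integrable_exp_sq_of_expMoment_le hX h
  have hI2 := integral_exp_sq_le_two hX h
  have hint : ∀ t : ℝ, Integrable (fun ω => Real.exp (t * X ω)) μ := by
    intro t
    refine Integrable.mono' (hI.const_mul (Real.exp (t ^ 2 / (4 * a)))) (by fun_prop)
      (Filter.Eventually.of_forall fun ω => ?_)
    rw [Real.norm_eq_abs, Real.abs_exp, ← Real.exp_add]
    apply Real.exp_le_exp.2
    have : t ^ 2 / (4 * a) + a * X ω ^ 2 - t * X ω = (t - 2 * a * X ω) ^ 2 / (4 * a) := by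
      field_simp; ring
    have h2 : 0 ≤ (t - 2 * a * X ω) ^ 2 / (4 * a) := by positivity
    linarith
  have hXi : Integrable X μ := by
    refine Integrable.mono' ((hint 1).add (hint (-1))) hX.aestronglyMeasurable
      (Filter.Eventually.of_forall fun ω => ?_)
    simp only [Pi.add_apply, one_mul, neg_mul, Real.norm_eq_abs]
    rcases abs_cases (X ω) with h | h <;>
    nlinarith [Real.add_one_le_exp (X ω), Real.add_one_le_exp (-X ω), Real.exp_pos (X ω),
      Real.exp_pos (-X ω)]
  refine ⟨hint, fun t => ?_⟩
  rw [Real.coe_toNNReal _ (by positivity), mgf]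
  have hc : 2 / a * t ^ 2 / 2 = t ^ 2 / a := by field_simp
  rw [hc]
  set s := t ^ 2 / a with hs
  have hs0 : 0 ≤ s := by positivity
  have hint1 : Integrable (fun ω => 1 + s * (Real.exp (a * X ω ^ 2) - 1)) μ :=
    (integrable_const _).add ((hI.sub (integrable_const _)).const_mul _)
  have hval : ∀ s : ℝ, ∫ ω, (1 + s * (Real.exp (a * X ω ^ 2) - 1)) ∂μ
      = 1 + s * (∫ ω, Real.exp (a * X ω ^ 2) ∂μ - 1) := by
    intro s
    have hi : Integrable (fun ω => Real.exp (a * X ω ^ 2) - 1) μ := hI.sub (integrable_const _)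
    rw [integral_add (integrable_const _) (hi.const_mul _), integral_const_mul,
      integral_sub hI (integrable_const _)]
    simp
  by_cases h1 : s ≤ 1
  · have hle : ∀ ω, Real.exp (t * X ω) ≤
        t * X ω + (1 + s * (Real.exp (a * X ω ^ 2) - 1)) := by
      intro ω
      refine (exp_le_add_exp_sq _).trans ?_
      have h3 : (t * X ω) ^ 2 = s * (a * X ω ^ 2) := by rw [hs]; field_simp
      rw [h3]
      linarith [exp_mul_le_chord (y := a * X ω ^ 2) hs0 h1]
    calc ∫ ω, Real.exp (t * X ω) ∂μ
        ≤ ∫ ω, (t * X ω + (1 + s * (Real.exp (a * X ω ^ 2) - 1))) ∂μ :=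
          integral_mono (hint t) ((hXi.const_mul t).add hint1) hle
      _ = 1 + s * (∫ ω, Real.exp (a * X ω ^ 2) ∂μ - 1) := by
          rw [integral_add (hXi.const_mul t) hint1, integral_const_mul, h0, hval]; ring
      _ ≤ 1 + s * 1 := by gcongr; linarith
      _ ≤ Real.exp s := by linarith [Real.add_one_le_exp s]
  · push Not at h1
    have hle : ∀ ω, Real.exp (t * X ω) ≤
        Real.exp (s / 2) * (1 + 1 / 2 * (Real.exp (a * X ω ^ 2) - 1)) := by
      intro ω
      refine le_trans ?_ (mul_le_mul_of_nonneg_left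
        (exp_mul_le_chord (s := 1 / 2) (y := a * X ω ^ 2) (by norm_num) (by norm_num))
        (Real.exp_pos _).le)
      rw [← Real.exp_add]
      apply Real.exp_le_exp.2
      have : s / 2 + 1 / 2 * (a * X ω ^ 2) - t * X ω = (t - a * X ω) ^ 2 / (2 * a) := by
        rw [hs]; field_simp; ring
      have h2 : 0 ≤ (t - a * X ω) ^ 2 / (2 * a) := by positivity
      linarith
    have hint2 : Integrable (fun ω => 1 + 1 / 2 * (Real.exp (a * X ω ^ 2) - 1)) μ :=
      (integrable_const _).add ((hI.sub (integrable_const _)).const_mul _)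
    calc ∫ ω, Real.exp (t * X ω) ∂μ
        ≤ ∫ ω, Real.exp (s / 2) * (1 + 1 / 2 * (Real.exp (a * X ω ^ 2) - 1)) ∂μ :=
          integral_mono (hint t) (hint2.const_mul _) hle
      _ = Real.exp (s / 2) * (1 + 1 / 2 * (∫ ω, Real.exp (a * X ω ^ 2) ∂μ - 1)) := by
          rw [integral_const_mul, hval]
      _ ≤ Real.exp (s / 2) * Real.exp (s / 2) := by
          gcongr
          linarith [Real.add_one_le_exp (s / 2)]
      _ = Real.exp s := by rw [← Real.exp_add]; ring_nf

/-- The lower tail of the square: `e ^ {-y} ≤ 1 - y + y² / 2` and a fourth moment bound. -/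
lemma expMoment_neg_sq_le (ha : 0 < a) (hX : Measurable X)
    (h1 : ∫ ω, X ω ^ 2 ∂μ = 1) (h : expMoment μ (fun ω => a * X ω ^ 2) ≤ 2) {b : ℝ} (hb : 0 ≤ b) :
    expMoment μ (fun ω => -(b * X ω ^ 2)) ≤
      ENNReal.ofReal (Real.exp (-b + 2 * b ^ 2 / a ^ 2)) := by
  have hI := integrable_exp_sq_of_expMoment_le hX h
  have hI2 := integral_exp_sq_le_two hX h
  have hq : Integrable (fun ω => X ω ^ 2) μ := by
    by_contra hc
    rw [integral_undef hc] at h1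
    norm_num at h1
  have hle : ∀ ω, Real.exp (-(b * X ω ^ 2)) ≤
      1 - b * X ω ^ 2 + b ^ 2 / a ^ 2 * Real.exp (a * X ω ^ 2) := by
    intro ω
    have hy : 0 ≤ b * X ω ^ 2 := by positivity
    have e1 : Real.exp (-(b * X ω ^ 2)) ≤ 1 - b * X ω ^ 2 + (b * X ω ^ 2) ^ 2 / 2 := by
      rw [Real.exp_neg, inv_le_iff_one_le_mul₀ (Real.exp_pos _)]
      have := Real.quadratic_le_exp_of_nonneg hy
      set y := b * X ω ^ 2
      calc (1 : ℝ) ≤ (1 - y + y ^ 2 / 2) * (1 + y + y ^ 2 / 2) := by nlinarith [sq_nonneg (y ^ 2)]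
        _ ≤ _ := by
          apply mul_le_mul_of_nonneg_left this
          nlinarith [sq_nonneg (y - 1)]
    have e2 := Real.quadratic_le_exp_of_nonneg (x := a * X ω ^ 2) (by positivity)
    have e3 : (b * X ω ^ 2) ^ 2 / 2 = b ^ 2 / a ^ 2 * ((a * X ω ^ 2) ^ 2 / 2) := by
      field_simp
    have e4 : b ^ 2 / a ^ 2 * ((a * X ω ^ 2) ^ 2 / 2) ≤ b ^ 2 / a ^ 2 * Real.exp (a * X ω ^ 2) := by
      have : 0 ≤ a * X ω ^ 2 := by positivity
      gcongr
      linarith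
    linarith
  have hd1 : Integrable (fun ω => (1 : ℝ) - b * X ω ^ 2) μ :=
    (integrable_const _).sub (hq.const_mul b)
  have hd := hd1.add (hI.const_mul (b ^ 2 / a ^ 2))
  have hexpi : Integrable (fun ω => Real.exp (-(b * X ω ^ 2))) μ := by
    refine Integrable.mono' (integrable_const (1 : ℝ)) (by fun_prop)
      (Filter.Eventually.of_forall fun ω => ?_)
    rw [Real.norm_eq_abs, Real.abs_exp, Real.exp_le_one_iff]
    have : 0 ≤ b * X ω ^ 2 := by positivity
    linarith
  unfold expMoment
  rw [← ofReal_integral_eq_lintegral_ofReal hexpi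
    (Filter.Eventually.of_forall fun ω => (Real.exp_pos _).le)]
  apply ENNReal.ofReal_le_ofReal
  calc ∫ ω, Real.exp (-(b * X ω ^ 2)) ∂μ
      ≤ ∫ ω, (1 - b * X ω ^ 2 + b ^ 2 / a ^ 2 * Real.exp (a * X ω ^ 2)) ∂μ :=
        integral_mono hexpi hd hle
    _ = 1 - b * 1 + b ^ 2 / a ^ 2 * ∫ ω, Real.exp (a * X ω ^ 2) ∂μ := by
        rw [integral_add hd1 (hI.const_mul _), integral_sub (integrable_const _) (hq.const_mul b),
          integral_const_mul, integral_const_mul, h1]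
        simp
    _ ≤ 1 - b * 1 + b ^ 2 / a ^ 2 * 2 := by gcongr
    _ = (-b + 2 * b ^ 2 / a ^ 2) + 1 := by ring
    _ ≤ _ := Real.add_one_le_exp _

end OneDim

/-! ### Self-normalised off-diagonal forms -/

lemma expMoment_linear_le {Ω : Type u} [MeasurableSpace Ω] {μ : Measure Ω} {ι : Type*}
    {ξ : ι → Ω → ℝ} (hind : iIndepFun ξ μ) {c : ℝ≥0}
    (hsub : ∀ i, HasSubgaussianMGF (ξ i) c μ) (S : Finset ι) (t : ι → ℝ) :
    expMoment μ (fun ω => ∑ j ∈ S, t j * ξ j ω) ≤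
      ENNReal.ofReal (Real.exp (c * (∑ j ∈ S, t j ^ 2) / 2)) := by
  have hind' : iIndepFun (fun j ω => t j * ξ j ω) μ :=
    hind.comp (fun j x => t j * x) fun j => measurable_const_mul _
  have h := HasSubgaussianMGF.sum_of_iIndepFun hind' (s := S) fun j _ => (hsub j).const_mul (t j)
  have h1 := h.mgf_le 1
  have h2 := h.integrable_exp_mul 1
  simp only [mgf, one_mul] at h1 h2
  unfold expMoment
  rw [← ofReal_integral_eq_lintegral_ofReal h2
    (Filter.Eventually.of_forall fun ω => (Real.exp_pos _).le)]
  apply ENNReal.ofReal_le_ofReal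
  refine h1.trans (le_of_eq ?_)
  congr 1
  push_cast
  rw [Finset.mul_sum]
  rw [one_pow, mul_one]
  congr 1
  refine Finset.sum_congr rfl fun i _ => ?_
  change t i ^ 2 * (c : ℝ) = c * t i ^ 2
  ring

/-- The decoupled estimate: the coordinates in `S` are integrated first, the others being fixed. -/
lemma expMoment_decoupled_le_one {Ω : Type u} [MeasurableSpace Ω] {μ : Measure Ω}
    {ι : Type*} [Fintype ι] [DecidableEq ι]
    {ξ : ι → Ω → ℝ} (hξ : ∀ i, Measurable (ξ i)) (hind : iIndepFun ξ μ) {c : ℝ≥0}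
    (hsub : ∀ i, HasSubgaussianMGF (ξ i) c μ) (N : ι → ι → ℝ) (S : Finset ι) (θ : ℝ) :
    expMoment μ (fun ω => θ * ∑ j ∈ S, ξ j ω * ∑ k ∈ Sᶜ, N j k * ξ k ω
      - c * θ ^ 2 / 2 * ∑ j ∈ S, (∑ k ∈ Sᶜ, N j k * ξ k ω) ^ 2) ≤ 1 := by
  have : IsProbabilityMeasure μ := hind.isProbabilityMeasure
  have hI := hind.indepFun_finset S Sᶜ disjoint_compl_right hξ
  have hX : Measurable (fun a (i : S) => ξ i a) := measurable_pi_lambda _ fun i => hξ i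
  have hY : Measurable (fun a (i : (Sᶜ : Finset ι)) => ξ i a) :=
    measurable_pi_lambda _ fun i => hξ i
  rw [indepFun_iff_map_prod_eq_prod_map_map hX.aemeasurable hY.aemeasurable] at hI
  have hPX := Measure.isProbabilityMeasure_map (μ := μ) hX.aemeasurable
  have hPY := Measure.isProbabilityMeasure_map (μ := μ) hY.aemeasurable
  let t : ((Sᶜ : Finset ι) → ℝ) → ι → ℝ := fun y j => ∑ k : (Sᶜ : Finset ι), N j k * y k
  let F : (S → ℝ) × ((Sᶜ : Finset ι) → ℝ) → ℝ≥0∞ := fun z =>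
    ENNReal.ofReal (Real.exp (θ * ∑ j : S, z.1 j * t z.2 j
      - c * θ ^ 2 / 2 * ∑ j : S, t z.2 j ^ 2))
  have hF : Measurable F := by
    simp only [F, t]
    fun_prop
  have h1 : expMoment μ (fun ω => θ * ∑ j ∈ S, ξ j ω * ∑ k ∈ Sᶜ, N j k * ξ k ω
      - c * θ ^ 2 / 2 * ∑ j ∈ S, (∑ k ∈ Sᶜ, N j k * ξ k ω) ^ 2)
      = ∫⁻ ω, F (fun i : S => ξ i ω, fun i : (Sᶜ : Finset ι) => ξ i ω) ∂μ := by
    unfold expMoment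
    refine lintegral_congr fun ω => ?_
    simp only [F, t]
    have e : ∀ j, ∑ k : (Sᶜ : Finset ι), N j k * ξ k ω = ∑ k ∈ Sᶜ, N j k * ξ k ω := fun j =>
      Finset.sum_coe_sort (Sᶜ) fun k => N j k * ξ k ω
    simp_rw [e]
    rw [Finset.sum_coe_sort S fun j => ξ j ω * ∑ k ∈ Sᶜ, N j k * ξ k ω,
      Finset.sum_coe_sort S fun j => (∑ k ∈ Sᶜ, N j k * ξ k ω) ^ 2]
  rw [h1, ← lintegral_map (f := F) hF (hX.prodMk hY), hI, lintegral_prod_symm _ hF.aemeasurable]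
  have h2 : ∀ y, ∫⁻ x, F (x, y) ∂(μ.map fun a (i : S) => ξ i a) ≤ 1 := by
    intro y
    rw [lintegral_map (f := fun x => F (x, y)) (hF.comp measurable_prodMk_right) hX]
    have h3 := expMoment_linear_le hind hsub S (fun j => θ * t y j)
    have h4 : ∫⁻ ω, F (fun i : S => ξ i ω, y) ∂μ = expMoment μ
        (fun ω => -(c * θ ^ 2 / 2 * ∑ j ∈ S, t y j ^ 2) + ∑ j ∈ S, (θ * t y j) * ξ j ω) := by
      unfold expMoment
      refine lintegral_congr fun ω => ?_
      simp only [F]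
      rw [Finset.sum_coe_sort S fun j => ξ j ω * t y j, Finset.sum_coe_sort S fun j => t y j ^ 2]
      congr 2
      rw [Finset.mul_sum S (fun j => ξ j ω * t y j), sub_eq_neg_add]
      congr 1
      exact Finset.sum_congr rfl fun j _ => by ring
    rw [h4, expMoment_const_add]
    refine (mul_le_mul_right h3 _).trans (le_of_eq ?_)
    rw [← ENNReal.ofReal_mul (Real.exp_pos _).le, ← Real.exp_add]
    simp_rw [mul_pow]
    rw [← Finset.mul_sum]
    ring_nf
    simp
  calc ∫⁻ y, ∫⁻ x, F (x, y) ∂(μ.map fun a (i : S) => ξ i a)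
        ∂(μ.map fun a (i : (Sᶜ : Finset ι)) => ξ i a)
      ≤ ∫⁻ _, 1 ∂(μ.map fun a (i : (Sᶜ : Finset ι)) => ξ i a) := lintegral_mono h2
    _ = 1 := by simp

section Signs

variable {ι : Type*} [Fintype ι] [DecidableEq ι]

/-- The sign attached to the coordinate `j` by a subset `S`. -/
noncomputable def subsetSign (S : Finset ι) (j : ι) : ℝ := if j ∈ S then 1 else -1

lemma subsetSign_sq {ι : Type*} [DecidableEq ι] (S : Finset ι) (j : ι) : subsetSign S j ^ 2 = 1 := by
  unfold subsetSign; split_ifs <;> norm_num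

/-- Flipping the membership of `j` shows that `subsetSign · j` is orthogonal to every function of
`S` that does not depend on whether `j ∈ S`. -/
lemma sum_subsetSign_mul_eq_zero (j : ι) (g : Finset ι → ℝ)
    (hg : ∀ S, g (symmDiff S {j}) = g S) : ∑ S, subsetSign S j * g S = 0 := by
  have h := Equiv.sum_comp (symmDiff_left_involutive ({j} : Finset ι)).toPerm
    fun S => subsetSign S j * g S
  have h2 : ∀ S : Finset ι, subsetSign (symmDiff S {j}) j = -subsetSign S j := by
    intro S
    unfold subsetSign
    by_cases hj : j ∈ S <;> simp [Finset.mem_symmDiff, hj]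
  simp only [Function.Involutive.coe_toPerm, hg, h2, neg_mul, Finset.sum_neg_distrib] at h
  linarith

lemma sum_subsetSign (j : ι) : ∑ S, subsetSign S j = 0 := by
  simpa using sum_subsetSign_mul_eq_zero j (fun _ => 1) fun _ => rfl

lemma sum_subsetSign_mul_subsetSign {j k : ι} (h : j ≠ k) :
    ∑ S, subsetSign S j * subsetSign S k = 0 := by
  refine sum_subsetSign_mul_eq_zero j (fun S => subsetSign S k) fun S => ?_
  simp [subsetSign, Finset.mem_symmDiff, h.symm]

/-- Khintchine's identity for the second moment of a sign sum. -/
lemma sum_sq_sum_subsetSign_mul (a : ι → ℝ) :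
    ∑ S, (∑ k, subsetSign S k * a k) ^ 2 = (Finset.univ : Finset (Finset ι)).card * ∑ k, a k ^ 2 := by
  have h1 : ∀ S : Finset ι, (∑ k, subsetSign S k * a k) ^ 2
      = ∑ k, ∑ l, a k * a l * (subsetSign S k * subsetSign S l) := by
    intro S
    rw [sq, Finset.sum_mul_sum]
    exact Finset.sum_congr rfl fun k _ => Finset.sum_congr rfl fun l _ => by ring
  simp_rw [h1]
  rw [Finset.sum_comm, Finset.mul_sum]
  refine Finset.sum_congr rfl fun k _ => ?_
  rw [Finset.sum_comm, Finset.sum_eq_single k]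
  · simp_rw [← Finset.mul_sum, ← sq, subsetSign_sq]
    simp; ring
  · intro l _ hl
    rw [← Finset.mul_sum, sum_subsetSign_mul_subsetSign hl.symm, mul_zero]
  · simp

lemma sum_decoupled_eq (N : ι → ι → ℝ) (hN : ∀ i, N i i = 0) (x : ι → ℝ) :
    ∑ S : Finset ι, ∑ j ∈ S, x j * ∑ k ∈ Sᶜ, N j k * x k
      = (Finset.univ : Finset (Finset ι)).card * ((∑ j, x j * ∑ k, N j k * x k) / 4) := by
  have h1 : ∀ S : Finset ι, ∑ j ∈ S, x j * ∑ k ∈ Sᶜ, N j k * x k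
      = ∑ j, ∑ k, (x j * N j k * x k / 4) *
          (1 + subsetSign S j - subsetSign S k - subsetSign S j * subsetSign S k) := by
    intro S
    have e : ∀ (T : Finset ι) (g : ι → ℝ), ∑ j ∈ T, g j = ∑ j, if j ∈ T then g j else 0 :=
      fun T g => by simp
    rw [e S]
    refine Finset.sum_congr rfl fun j _ => ?_
    by_cases hj : j ∈ S
    · rw [if_pos hj, e Sᶜ, Finset.mul_sum]
      refine Finset.sum_congr rfl fun k _ => ?_
      by_cases hk : k ∈ S <;> simp [subsetSign, hj, hk]
      ring
    · rw [if_neg hj]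
      refine (Finset.sum_eq_zero fun k _ => ?_).symm
      rw [subsetSign, if_neg hj]
      ring
  simp_rw [h1]
  rw [Finset.sum_comm, Finset.sum_div, Finset.mul_sum]
  refine Finset.sum_congr rfl fun j _ => ?_
  rw [Finset.sum_comm, Finset.mul_sum, Finset.sum_div, Finset.mul_sum]
  refine Finset.sum_congr rfl fun k _ => ?_
  rw [← Finset.mul_sum, Finset.sum_sub_distrib, Finset.sum_sub_distrib, Finset.sum_add_distrib,
    sum_subsetSign, sum_subsetSign]
  by_cases h : j = k
  · subst h; simp [hN]
  · rw [sum_subsetSign_mul_subsetSign h]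
    simp; ring

lemma sum_decoupled_sq_le (N : ι → ι → ℝ) (x : ι → ℝ) :
    ∑ S : Finset ι, ∑ j ∈ S, (∑ k ∈ Sᶜ, N j k * x k) ^ 2
      ≤ (Finset.univ : Finset (Finset ι)).card *
        ((∑ j, (∑ k, N j k * x k) ^ 2 + ∑ j, ∑ k, N j k ^ 2 * x k ^ 2) / 2) := by
  have h0 : ∀ (S : Finset ι) j, ∑ k ∈ Sᶜ, N j k * x k
      = (∑ k, N j k * x k - ∑ k, subsetSign S k * (N j k * x k)) / 2 := by
    intro S j
    rw [← Finset.sum_sub_distrib, Finset.sum_div, ← Finset.sum_add_sum_compl S]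
    rw [Finset.sum_eq_zero (s := S), zero_add]
    · refine Finset.sum_congr rfl fun k hk => ?_
      rw [subsetSign, if_neg (Finset.mem_compl.1 hk)]; ring
    · intro k hk
      rw [subsetSign, if_pos hk]; ring
  have h1 : ∀ S : Finset ι, ∑ j ∈ S, (∑ k ∈ Sᶜ, N j k * x k) ^ 2 ≤
      ∑ j, ((∑ k, N j k * x k) ^ 2 + (∑ k, subsetSign S k * (N j k * x k)) ^ 2) / 2 := by
    intro S
    refine (Finset.sum_le_univ_sum_of_nonneg fun j => sq_nonneg _).trans
      (Finset.sum_le_sum fun j _ => ?_)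
    rw [h0]
    nlinarith [sq_nonneg (∑ k, N j k * x k + ∑ k, subsetSign S k * (N j k * x k))]
  refine (Finset.sum_le_sum fun S _ => h1 S).trans (le_of_eq ?_)
  rw [Finset.sum_comm, ← Finset.sum_add_distrib, Finset.sum_div, Finset.mul_sum]
  refine Finset.sum_congr rfl fun j _ => ?_
  rw [← Finset.sum_div, Finset.sum_add_distrib, sum_sq_sum_subsetSign_mul]
  simp_rw [mul_pow]
  simp; ring

end Signs

/-- A self-normalised inequality for off-diagonal quadratic forms in independent subgaussian
variables. The form is four times the average of its decoupled versions over the subsets of the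
coordinates, so Jensen's inequality reduces the claim to the decoupled estimate; the compensator
averages to at most the stated one. No smallness of `t` is needed. -/
lemma expMoment_offDiag_le_one {Ω : Type u} [MeasurableSpace Ω] {μ : Measure Ω}
    {ι : Type*} [Fintype ι]
    {ξ : ι → Ω → ℝ} (hξ : ∀ i, Measurable (ξ i)) (hind : iIndepFun ξ μ) {c : ℝ≥0}
    (hsub : ∀ i, HasSubgaussianMGF (ξ i) c μ) (N : ι → ι → ℝ) (hN : ∀ i, N i i = 0) (t : ℝ) :
    expMoment μ (fun ω => t * ∑ j, ξ j ω * ∑ k, N j k * ξ k ω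
      - 4 * c * t ^ 2 * (∑ j, (∑ k, N j k * ξ k ω) ^ 2
        + ∑ j, ∑ k, N j k ^ 2 * ξ k ω ^ 2)) ≤ 1 := by
  classical
  set M : ℝ := (((Finset.univ : Finset (Finset ι)).card : ℕ) : ℝ) with hM
  have hM0 : 0 < M := by
    rw [hM]; exact_mod_cast Finset.card_pos.2 Finset.univ_nonempty
  let G : Finset ι → Ω → ℝ := fun S ω => 4 * t * ∑ j ∈ S, ξ j ω * ∑ k ∈ Sᶜ, N j k * ξ k ω
      - c * (4 * t) ^ 2 / 2 * ∑ j ∈ S, (∑ k ∈ Sᶜ, N j k * ξ k ω) ^ 2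
  have hG : ∀ ω, t * ∑ j, ξ j ω * ∑ k, N j k * ξ k ω
      - 4 * c * t ^ 2 * (∑ j, (∑ k, N j k * ξ k ω) ^ 2 + ∑ j, ∑ k, N j k ^ 2 * ξ k ω ^ 2)
      ≤ ∑ S, M⁻¹ * G S ω := by
    intro ω
    rw [← Finset.mul_sum, Finset.sum_sub_distrib, ← Finset.mul_sum, ← Finset.mul_sum,
      sum_decoupled_eq N hN fun k => ξ k ω, ← hM]
    have h := sum_decoupled_sq_le N fun k => ξ k ω
    rw [← hM] at h
    have h' := mul_le_mul_of_nonneg_left h (by positivity : 0 ≤ M⁻¹ * (c * (4 * t) ^ 2 / 2))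
    have e : M⁻¹ * M = 1 := inv_mul_cancel₀ hM0.ne'
    set A := ∑ j, ξ j ω * ∑ k, N j k * ξ k ω
    set B := ∑ j, (∑ k, N j k * ξ k ω) ^ 2 + ∑ j, ∑ k, N j k ^ 2 * ξ k ω ^ 2
    set D := ∑ S : Finset ι, ∑ j ∈ S, (∑ k ∈ Sᶜ, N j k * ξ k ω) ^ 2
    have e1 : M⁻¹ * (c * (4 * t) ^ 2 / 2) * (M * (B / 2)) = 4 * c * t ^ 2 * B := by
      linear_combination (4 * c * t ^ 2 * B) * e
    have e2 : M⁻¹ * (4 * t * (M * (A / 4))) = t * A := by linear_combination (t * A) * e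
    rw [mul_sub, e2]
    linarith
  have hJ : ∀ ω, ENNReal.ofReal (Real.exp (∑ S, M⁻¹ * G S ω))
      ≤ ∑ S, ENNReal.ofReal M⁻¹ * ENNReal.ofReal (Real.exp (G S ω)) := by
    intro ω
    have h := convexOn_exp.map_sum_le (t := Finset.univ) (w := fun _ : Finset ι => M⁻¹)
      (p := fun S => G S ω) (fun _ _ => by positivity)
      (by simp only [Finset.sum_const, nsmul_eq_mul]; exact mul_inv_cancel₀ hM0.ne')
      (fun _ _ => Set.mem_univ _)
    simp only [smul_eq_mul] at h
    refine (ENNReal.ofReal_le_ofReal h).trans (le_of_eq ?_)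
    rw [ENNReal.ofReal_sum_of_nonneg fun S _ => by positivity]
    exact Finset.sum_congr rfl fun S _ => ENNReal.ofReal_mul (by positivity)
  refine (expMoment_mono hG).trans ?_
  calc expMoment μ (fun ω => ∑ S, M⁻¹ * G S ω)
      ≤ ∫⁻ ω, ∑ S, ENNReal.ofReal M⁻¹ * ENNReal.ofReal (Real.exp (G S ω)) ∂μ :=
        lintegral_mono hJ
    _ = ∑ S, ENNReal.ofReal M⁻¹ * expMoment μ (G S) := by
        rw [lintegral_finsetSum]
        · refine Finset.sum_congr rfl fun S _ => ?_
          rw [lintegral_const_mul' _ _ ENNReal.ofReal_ne_top, expMoment]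
        · intro S _
          simp only [G]
          fun_prop
    _ ≤ ∑ S : Finset ι, ENNReal.ofReal M⁻¹ * 1 := by
        refine Finset.sum_le_sum fun S _ => mul_le_mul_right ?_ _
        exact expMoment_decoupled_le_one hξ hind hsub N S (4 * t)
    _ = 1 := by
        simp only [mul_one, Finset.sum_const, nsmul_eq_mul]
        rw [← ENNReal.ofReal_natCast, ← ENNReal.ofReal_mul (by positivity), ← hM,
          mul_inv_cancel₀ hM0.ne', ENNReal.ofReal_one]

/-! ### Weighted forms of a unitary matrix -/

section Forms

variable {𝕜 : Type w} [RCLike 𝕜] {n : ℕ}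

lemma sum_norm_sq_mulVec_of_mem_unitaryGroup {U : Matrix (Fin n) (Fin n) 𝕜}
    (hU : U ∈ Matrix.unitaryGroup (Fin n) 𝕜) (y : Fin n → 𝕜) :
    ∑ i, ‖U.mulVec y i‖ ^ 2 = ∑ i, ‖y i‖ ^ 2 := by
  have key : ∀ z : Fin n → 𝕜, dotProduct (star z) z = ((∑ i, ‖z i‖ ^ 2 : ℝ) : 𝕜) := by
    intro z
    simp [dotProduct, RCLike.conj_mul]
  have h : dotProduct (star (U.mulVec y)) (U.mulVec y) = dotProduct (star y) y := by
    rw [Matrix.star_mulVec, Matrix.dotProduct_mulVec, Matrix.vecMul_vecMul,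
      ← Matrix.star_eq_conjTranspose, Matrix.mem_unitaryGroup_iff'.1 hU, Matrix.vecMul_one]
  rw [key, key] at h
  exact_mod_cast h

lemma sum_norm_sq_row_of_mem_unitaryGroup {U : Matrix (Fin n) (Fin n) 𝕜}
    (hU : U ∈ Matrix.unitaryGroup (Fin n) 𝕜) (i : Fin n) : ∑ k, ‖U i k‖ ^ 2 = 1 := by
  have h := congrFun (congrFun (Matrix.mem_unitaryGroup_iff.1 hU) i) i
  rw [Matrix.mul_apply, Matrix.one_apply_eq] at h
  have h2 : ((∑ k, ‖U i k‖ ^ 2 : ℝ) : 𝕜) = 1 := by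
    rw [← h]
    simp [Matrix.star_apply, RCLike.mul_conj]
  exact_mod_cast h2

/-- The quadratic form `∑ dᵢ |(O x)ᵢ|²` of a real vector `x`. -/
noncomputable def weightedForm (O : Matrix (Fin n) (Fin n) 𝕜) (d : Fin n → ℝ) (x : Fin n → ℝ) : ℝ :=
  ∑ i, d i * ‖O.mulVec (fun k => ((x k : ℝ) : 𝕜)) i‖ ^ 2

/-- The diagonal part `∑ₖ (∑ᵢ dᵢ |Oᵢₖ|²) xₖ²` of `weightedForm`. -/
noncomputable def diagonalForm (O : Matrix (Fin n) (Fin n) 𝕜) (d : Fin n → ℝ) (x : Fin n → ℝ) : ℝ :=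
  ∑ k, (∑ i, d i * ‖O i k‖ ^ 2) * x k ^ 2

/-- The real symmetric matrix of `weightedForm`. -/
noncomputable def gramWeight (O : Matrix (Fin n) (Fin n) 𝕜) (d : Fin n → ℝ) (j k : Fin n) : ℝ :=
  ∑ i, d i * RCLike.re (star (O i j) * O i k)

lemma gramWeight_self (O : Matrix (Fin n) (Fin n) 𝕜) (d : Fin n → ℝ) (k : Fin n) :
    gramWeight O d k k = ∑ i, d i * ‖O i k‖ ^ 2 := by
  unfold gramWeight
  refine Finset.sum_congr rfl fun i _ => ?_
  rw [RCLike.star_def, RCLike.conj_mul]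
  norm_cast

lemma sum_gramWeight_mul (O : Matrix (Fin n) (Fin n) 𝕜) (d x : Fin n → ℝ) (j : Fin n) :
    ∑ k, gramWeight O d j k * x k = RCLike.re ((star O).mulVec
      (fun i => ((d i : ℝ) : 𝕜) * O.mulVec (fun k => ((x k : ℝ) : 𝕜)) i) j) := by
  simp only [Matrix.mulVec, dotProduct, gramWeight, Finset.mul_sum, map_sum, Finset.sum_mul,
    Matrix.star_apply]
  rw [Finset.sum_comm]
  refine Finset.sum_congr rfl fun i _ => Finset.sum_congr rfl fun k _ => ?_
  have : star (O i j) * (((d i : ℝ) : 𝕜) * (O i k * ((x k : ℝ) : 𝕜)))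
      = ((d i * x k : ℝ) : 𝕜) * (star (O i j) * O i k) := by push_cast; ring
  rw [this, RCLike.re_ofReal_mul]
  ring

lemma weightedForm_eq_sum (O : Matrix (Fin n) (Fin n) 𝕜) (d x : Fin n → ℝ) :
    weightedForm O d x = ∑ j, x j * ∑ k, gramWeight O d j k * x k := by
  unfold weightedForm
  simp_rw [sum_gramWeight_mul]
  have h : ∀ j, x j * RCLike.re ((star O).mulVec
      (fun i => ((d i : ℝ) : 𝕜) * O.mulVec (fun k => ((x k : ℝ) : 𝕜)) i) j)
      = ∑ i, RCLike.re (d i * (star (O i j * ((x j : ℝ) : 𝕜)) *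
          O.mulVec (fun k => ((x k : ℝ) : 𝕜)) i)) := by
    intro j
    rw [Matrix.mulVec, dotProduct, map_sum, Finset.mul_sum]
    refine Finset.sum_congr rfl fun i _ => ?_
    rw [← RCLike.re_ofReal_mul]
    congr 1
    simp only [Matrix.star_apply, star_mul', RCLike.star_def, RCLike.conj_ofReal]
    ring
  simp_rw [h]
  rw [Finset.sum_comm]
  refine Finset.sum_congr rfl fun i _ => ?_
  rw [← map_sum, ← Finset.mul_sum, ← Finset.sum_mul, ← star_sum]
  have e : ∑ j, O i j * ((x j : ℝ) : 𝕜) = O.mulVec (fun k => ((x k : ℝ) : 𝕜)) i := rfl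
  rw [e, RCLike.star_def, RCLike.conj_mul, RCLike.re_ofReal_mul]
  norm_cast

lemma sum_sq_gramWeight_mul_le {O : Matrix (Fin n) (Fin n) 𝕜}
    (hO : O ∈ Matrix.unitaryGroup (Fin n) 𝕜) (d x : Fin n → ℝ) :
    ∑ j, (∑ k, gramWeight O d j k * x k) ^ 2 ≤ weightedForm O (fun i => d i ^ 2) x := by
  simp_rw [sum_gramWeight_mul]
  set y : Fin n → 𝕜 := fun i => ((d i : ℝ) : 𝕜) * O.mulVec (fun k => ((x k : ℝ) : 𝕜)) i with hy
  have hO' : star O ∈ Matrix.unitaryGroup (Fin n) 𝕜 := Unitary.star_mem hO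
  calc ∑ j, RCLike.re ((star O).mulVec y j) ^ 2 ≤ ∑ j, ‖(star O).mulVec y j‖ ^ 2 := by
        refine Finset.sum_le_sum fun j _ => ?_
        exact sq_le_sq.2 ((RCLike.abs_re_le_norm _).trans (le_abs_self _))
    _ = ∑ i, ‖y i‖ ^ 2 := sum_norm_sq_mulVec_of_mem_unitaryGroup hO' y
    _ = weightedForm O (fun i => d i ^ 2) x := by
        unfold weightedForm
        refine Finset.sum_congr rfl fun i _ => ?_
        rw [hy]
        simp only [norm_mul, RCLike.norm_ofReal, mul_pow, sq_abs]

lemma sum_sq_gramWeight_le {O : Matrix (Fin n) (Fin n) 𝕜}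
    (hO : O ∈ Matrix.unitaryGroup (Fin n) 𝕜) (d : Fin n → ℝ) (k : Fin n) :
    ∑ j, gramWeight O d j k ^ 2 ≤ ∑ i, d i ^ 2 * ‖O i k‖ ^ 2 := by
  have h := sum_sq_gramWeight_mul_le hO d (Pi.single k 1)
  have e1 : ∀ j, ∑ l, gramWeight O d j l * (Pi.single k 1 : Fin n → ℝ) l = gramWeight O d j k := by
    intro j
    simp [Pi.single_apply]
  have e2 : weightedForm O (fun i => d i ^ 2) (Pi.single k 1) = ∑ i, d i ^ 2 * ‖O i k‖ ^ 2 := by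
    unfold weightedForm
    refine Finset.sum_congr rfl fun i _ => ?_
    simp only [Matrix.mulVec, dotProduct, Pi.single_apply]
    simp
  simpa only [e1, e2] using h

/-- The self-normalised inequality for `weightedForm` minus its diagonal part. The compensator only
involves the two parts of the form with squared weights, since `O` is unitary. -/
lemma expMoment_weightedForm_sub_le_one {Ω : Type u} [MeasurableSpace Ω] {μ : Measure Ω}
    {ξ : Fin n → Ω → ℝ} (hξ : ∀ i, Measurable (ξ i)) (hind : iIndepFun ξ μ) {c : ℝ≥0}
    (hsub : ∀ i, HasSubgaussianMGF (ξ i) c μ) {O : Matrix (Fin n) (Fin n) 𝕜}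
    (hO : O ∈ Matrix.unitaryGroup (Fin n) 𝕜) (d : Fin n → ℝ) (t : ℝ) :
    expMoment μ (fun ω => t * (weightedForm O d (fun i => ξ i ω) -
        diagonalForm O d (fun i => ξ i ω))
      - 4 * c * t ^ 2 * (2 * weightedForm O (fun i => d i ^ 2) (fun i => ξ i ω)
        + 3 * diagonalForm O (fun i => d i ^ 2) (fun i => ξ i ω))) ≤ 1 := by
  set N : Fin n → Fin n → ℝ := fun j k => if j = k then 0 else gramWeight O d j k with hN
  refine le_trans (expMoment_mono fun ω => ?_)
    (expMoment_offDiag_le_one hξ hind hsub N (fun i => by simp [hN]) t)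
  set x : Fin n → ℝ := fun i => ξ i ω with hx
  have hNx : ∀ j, ∑ k, N j k * x k = ∑ k, gramWeight O d j k * x k - gramWeight O d j j * x j := by
    intro j
    rw [← Finset.add_sum_erase _ _ (Finset.mem_univ j),
      ← Finset.add_sum_erase _ (fun k => gramWeight O d j k * x k) (Finset.mem_univ j)]
    simp only [hN, if_true, zero_mul, zero_add, add_sub_cancel_left]
    refine Finset.sum_congr rfl fun k hk => ?_
    rw [if_neg (Finset.ne_of_mem_erase hk).symm]
  have h1 : ∑ j, x j * ∑ k, N j k * x k = weightedForm O d x - diagonalForm O d x := by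
    rw [weightedForm_eq_sum, diagonalForm, ← Finset.sum_sub_distrib]
    refine Finset.sum_congr rfl fun j _ => ?_
    rw [hNx, gramWeight_self]
    ring
  have hcol : ∑ k, (∑ j, gramWeight O d j k ^ 2) * x k ^ 2 ≤
      diagonalForm O (fun i => d i ^ 2) x := by
    unfold diagonalForm
    exact Finset.sum_le_sum fun k _ =>
      mul_le_mul_of_nonneg_right (sum_sq_gramWeight_le hO d k) (sq_nonneg _)
  have hdiag : ∑ j, gramWeight O d j j ^ 2 * x j ^ 2 ≤ diagonalForm O (fun i => d i ^ 2) x := by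
    refine le_trans (Finset.sum_le_sum fun j _ => ?_) hcol
    gcongr
    exact Finset.single_le_sum (f := fun i => gramWeight O d i j ^ 2) (fun i _ => sq_nonneg _)
      (Finset.mem_univ j)
  have h2 : ∑ j, (∑ k, N j k * x k) ^ 2 ≤ 2 * weightedForm O (fun i => d i ^ 2) x
      + 2 * diagonalForm O (fun i => d i ^ 2) x := by
    have h3 := sum_sq_gramWeight_mul_le hO d x
    calc ∑ j, (∑ k, N j k * x k) ^ 2
        ≤ ∑ j, (2 * (∑ k, gramWeight O d j k * x k) ^ 2 + 2 * (gramWeight O d j j ^ 2 * x j ^ 2)) := by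
          refine Finset.sum_le_sum fun j _ => ?_
          rw [hNx]
          nlinarith [sq_nonneg (∑ k, gramWeight O d j k * x k + gramWeight O d j j * x j)]
      _ = 2 * ∑ j, (∑ k, gramWeight O d j k * x k) ^ 2
          + 2 * ∑ j, gramWeight O d j j ^ 2 * x j ^ 2 := by
          rw [Finset.sum_add_distrib, Finset.mul_sum, Finset.mul_sum]
      _ ≤ _ := by linarith
  have h4 : ∑ j, ∑ k, N j k ^ 2 * x k ^ 2 ≤ diagonalForm O (fun i => d i ^ 2) x := by
    refine le_trans ?_ hcol
    rw [Finset.sum_comm]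
    refine Finset.sum_le_sum fun k _ => ?_
    rw [Finset.sum_mul]
    refine Finset.sum_le_sum fun j _ => ?_
    gcongr ?_ * _
    simp only [hN]
    split_ifs
    · simpa using sq_nonneg (gramWeight O d j k)
    · exact le_rfl
  have h5 : 0 ≤ 4 * (c : ℝ) * t ^ 2 := by positivity
  have h6 := mul_le_mul_of_nonneg_left (add_le_add h2 h4) h5
  change t * (weightedForm O d x - diagonalForm O d x) - _ ≤
    t * ∑ j, x j * ∑ k, N j k * x k - 4 * c * t ^ 2 * (∑ j, (∑ k, N j k * x k) ^ 2
        + ∑ j, ∑ k, N j k ^ 2 * x k ^ 2)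
  rw [h1]
  linarith

lemma weightedForm_mono (O : Matrix (Fin n) (Fin n) 𝕜) {d e : Fin n → ℝ} (h : ∀ i, d i ≤ e i)
    (x : Fin n → ℝ) : weightedForm O d x ≤ weightedForm O e x := by
  unfold weightedForm
  gcongr with i
  exact h i

lemma diagonalForm_mono (O : Matrix (Fin n) (Fin n) 𝕜) {d e : Fin n → ℝ} (h : ∀ i, d i ≤ e i)
    (x : Fin n → ℝ) : diagonalForm O d x ≤ diagonalForm O e x := by
  unfold diagonalForm
  gcongr with k _ i
  exact h i

lemma weightedForm_nonneg (O : Matrix (Fin n) (Fin n) 𝕜) {d : Fin n → ℝ} (h : ∀ i, 0 ≤ d i)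
    (x : Fin n → ℝ) : 0 ≤ weightedForm O d x :=
  Finset.sum_nonneg fun i _ => mul_nonneg (h i) (sq_nonneg _)

lemma diagonalForm_nonneg (O : Matrix (Fin n) (Fin n) 𝕜) {d : Fin n → ℝ} (h : ∀ i, 0 ≤ d i)
    (x : Fin n → ℝ) : 0 ≤ diagonalForm O d x :=
  Finset.sum_nonneg fun _ _ => mul_nonneg
    (Finset.sum_nonneg fun i _ => mul_nonneg (h i) (sq_nonneg _)) (sq_nonneg _)

lemma weightedForm_linear (O : Matrix (Fin n) (Fin n) 𝕜) (a b : ℝ) (d e x : Fin n → ℝ) :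
    weightedForm O (fun i => a * d i + b * e i) x = a * weightedForm O d x + b * weightedForm O e x := by
  unfold weightedForm
  rw [Finset.mul_sum, Finset.mul_sum, ← Finset.sum_add_distrib]
  exact Finset.sum_congr rfl fun i _ => by ring

lemma diagonalForm_linear (O : Matrix (Fin n) (Fin n) 𝕜) (a b : ℝ) (d e x : Fin n → ℝ) :
    diagonalForm O (fun i => a * d i + b * e i) x = a * diagonalForm O d x + b * diagonalForm O e x := by
  unfold diagonalForm
  rw [Finset.mul_sum, Finset.mul_sum, ← Finset.sum_add_distrib]
  refine Finset.sum_congr rfl fun k _ => ?_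
  rw [← mul_assoc, ← mul_assoc, ← add_mul, Finset.mul_sum, Finset.mul_sum,
    ← Finset.sum_add_distrib]
  congr 1
  exact Finset.sum_congr rfl fun i _ => by ring

lemma measurable_weightedForm (O : Matrix (Fin n) (Fin n) 𝕜) (d : Fin n → ℝ) :
    Measurable (weightedForm O d) := by
  have : weightedForm O d = fun x => ∑ j, x j * ∑ k, gramWeight O d j k * x k :=
    funext fun x => weightedForm_eq_sum O d x
  rw [this]
  fun_prop

lemma measurable_diagonalForm (O : Matrix (Fin n) (Fin n) 𝕜) (d : Fin n → ℝ) :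
    Measurable (diagonalForm O d) := by
  unfold diagonalForm
  fun_prop

end Forms

/-! ### Forms in a subgaussian generator -/

/-- The rate `a = 1 / (4 e L²)`, for which `𝔼 exp (a ξᵢ²) ≤ 2`. -/
noncomputable def squareRate (L : ℝ) : ℝ := 1 / (4 * Real.exp 1 * L ^ 2)

lemma squareRate_pos {L : ℝ} (hL : 1 ≤ L) : 0 < squareRate L := by
  unfold squareRate; positivity

namespace IsSubgaussianGenerator

variable {Ω : Type u} [MeasurableSpace Ω] {μ : Measure Ω} {n : ℕ} {L : ℝ}
  {ξ : Fin n → Ω → ℝ}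

lemma integral_sq (h : IsSubgaussianGenerator μ L ξ) (i : Fin n) : ∫ ω, ξ i ω ^ 2 ∂μ = 1 := by
  rw [← variance_of_integral_eq_zero (h.measurable i).aemeasurable (h.mean_zero i),
    h.variance_one i]

lemma measurable_comp (h : IsSubgaussianGenerator μ L ξ) {f : (Fin n → ℝ) → ℝ}
    (hf : Measurable f) : Measurable fun ω => f fun i => ξ i ω :=
  hf.comp (measurable_pi_lambda _ h.measurable)

lemma expMoment_sum (h : IsSubgaussianGenerator μ L ξ) {f : Fin n → ℝ → ℝ}
    (hf : ∀ i, Measurable (f i)) :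
    expMoment μ (fun ω => ∑ i, f i (ξ i ω)) = ∏ i, expMoment μ fun ω => f i (ξ i ω) := by
  have hi : iIndepFun (fun i ω => ENNReal.ofReal (Real.exp (f i (ξ i ω)))) μ :=
    h.indep.comp (fun i x => ENNReal.ofReal (Real.exp (f i x))) fun i => by
      have := hf i
      fun_prop
  have hm : ∀ i, Measurable fun ω => ENNReal.ofReal (Real.exp (f i (ξ i ω))) := fun i =>
    ENNReal.measurable_ofReal.comp (Real.measurable_exp.comp ((hf i).comp (h.measurable i)))
  unfold expMoment
  rw [← lintegral_prod_eq_prod_lintegral_of_indepFun Finset.univ _ hi hm]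
  refine lintegral_congr fun ω => ?_
  rw [Real.exp_sum, ENNReal.ofReal_prod_of_nonneg fun i _ => (Real.exp_pos _).le]

variable [IsProbabilityMeasure μ]

lemma expMoment_sq_le_two (h : IsSubgaussianGenerator μ L ξ) (hL : 1 ≤ L) (i : Fin n) :
    expMoment μ (fun ω => squareRate L * ξ i ω ^ 2) ≤ 2 :=
  _root_.expMoment_sq_le_two hL (h.measurable i) (h.moments i)

lemma hasSubgaussianMGF (h : IsSubgaussianGenerator μ L ξ) (hL : 1 ≤ L) (i : Fin n) :
    HasSubgaussianMGF (ξ i) (Real.toNNReal (2 / squareRate L)) μ :=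
  hasSubgaussianMGF_of_expMoment_sq (squareRate_pos hL) (h.measurable i) (h.mean_zero i)
    (h.expMoment_sq_le_two hL i)

lemma measureReal_sum_sq_ge_le (h : IsSubgaussianGenerator μ L ξ) (hL : 1 ≤ L) :
    μ.real {ω | 2 * (n : ℝ) ≤ ∑ i, squareRate L * ξ i ω ^ 2} ≤ Real.exp (-n) := by
  have hm : Measurable fun ω => ∑ i, squareRate L * ξ i ω ^ 2 :=
    Finset.measurable_sum _ fun i _ => ((h.measurable i).pow_const 2).const_mul _
  have h1 : expMoment μ (fun ω => ∑ i, squareRate L * ξ i ω ^ 2)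
      ≤ ENNReal.ofReal (Real.exp n) := by
    rw [h.expMoment_sum (f := fun _ x => squareRate L * x ^ 2) fun i => by fun_prop]
    calc ∏ i, expMoment μ (fun ω => squareRate L * ξ i ω ^ 2) ≤ ∏ _i : Fin n, (2 : ℝ≥0∞) :=
          Finset.prod_le_prod' fun i _ => h.expMoment_sq_le_two hL i
      _ = ENNReal.ofReal (2 ^ n) := by
          rw [ENNReal.ofReal_pow (by norm_num)]; simp
      _ ≤ _ := by
          apply ENNReal.ofReal_le_ofReal
          rw [← Real.exp_one_pow]
          gcongr
          linarith [Real.add_one_le_exp 1]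
  refine (measureReal_le_of_expMoment_le hm h1).trans (le_of_eq ?_)
  congr 1; ring

variable {𝕜 : Type w} [RCLike 𝕜] {O : Matrix (Fin n) (Fin n) 𝕜}

/-- The lower tail of the diagonal part of a form of total weight one with flat columns. -/
lemma expMoment_neg_diagonalForm_le (h : IsSubgaussianGenerator μ L ξ) (hL : 1 ≤ L)
    (hO : O ∈ Matrix.unitaryGroup (Fin n) 𝕜) {d : Fin n → ℝ} (hd : ∀ i, 0 ≤ d i)
    (hd1 : ∑ i, d i = 1) {B : ℝ} (hB : ∀ k, ∑ i, d i * ‖O i k‖ ^ 2 ≤ B) {t : ℝ} (ht : 0 ≤ t) :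
    expMoment μ (fun ω => -(t * diagonalForm O d fun i => ξ i ω)) ≤
      ENNReal.ofReal (Real.exp (-t + 2 * t ^ 2 * B / squareRate L ^ 2)) := by
  set b : Fin n → ℝ := fun k => ∑ i, d i * ‖O i k‖ ^ 2 with hb
  have hb0 : ∀ k, 0 ≤ b k := fun k =>
    Finset.sum_nonneg fun i _ => mul_nonneg (hd i) (sq_nonneg _)
  have hb1 : ∑ k, b k = 1 := by
    rw [hb, Finset.sum_comm, ← hd1]
    refine Finset.sum_congr rfl fun i _ => ?_
    rw [← Finset.mul_sum, sum_norm_sq_row_of_mem_unitaryGroup hO, mul_one]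
  have e : (fun ω => -(t * diagonalForm O d fun i => ξ i ω))
      = fun ω => ∑ k, -((t * b k) * ξ k ω ^ 2) := by
    funext ω
    rw [diagonalForm, Finset.sum_neg_distrib, Finset.mul_sum]
    congr 1
    exact Finset.sum_congr rfl fun k _ => by rw [hb]; ring
  rw [e, h.expMoment_sum (f := fun k x => -((t * b k) * x ^ 2)) fun i => by fun_prop]
  calc ∏ k, expMoment μ (fun ω => -((t * b k) * ξ k ω ^ 2))
      ≤ ∏ k, ENNReal.ofReal (Real.exp (-(t * b k) + 2 * (t * b k) ^ 2 / squareRate L ^ 2)) :=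
        Finset.prod_le_prod' fun k _ => expMoment_neg_sq_le (squareRate_pos hL) (h.measurable k)
          (h.integral_sq k) (h.expMoment_sq_le_two hL k) (mul_nonneg ht (hb0 k))
    _ = ENNReal.ofReal (Real.exp
          (∑ k, (-(t * b k) + 2 * (t * b k) ^ 2 / squareRate L ^ 2))) := by
        rw [Real.exp_sum, ENNReal.ofReal_prod_of_nonneg fun i _ => (Real.exp_pos _).le]
    _ ≤ _ := by
        apply ENNReal.ofReal_le_ofReal
        apply Real.exp_le_exp.2
        rw [Finset.sum_add_distrib, Finset.sum_neg_distrib, ← Finset.mul_sum, hb1, mul_one]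
        have : ∀ k, 2 * (t * b k) ^ 2 / squareRate L ^ 2
            ≤ 2 * t ^ 2 * B / squareRate L ^ 2 * b k := by
          intro k
          have h1 : b k ^ 2 ≤ B * b k := by
            rw [sq]; exact mul_le_mul_of_nonneg_right (hB k) (hb0 k)
          calc 2 * (t * b k) ^ 2 / squareRate L ^ 2
              = 2 * t ^ 2 / squareRate L ^ 2 * b k ^ 2 := by ring
            _ ≤ 2 * t ^ 2 / squareRate L ^ 2 * (B * b k) := by gcongr
            _ = _ := by ring
        have h2 := Finset.sum_le_sum fun k (_ : k ∈ Finset.univ) => this k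
        rw [← Finset.mul_sum, hb1, mul_one] at h2
        linarith

lemma expMoment_chaos_le_one (h : IsSubgaussianGenerator μ L ξ) (hL : 1 ≤ L)
    (hO : O ∈ Matrix.unitaryGroup (Fin n) 𝕜) (d : Fin n → ℝ) (t : ℝ) :
    expMoment μ (fun ω => t * (weightedForm O d (fun i => ξ i ω) -
        diagonalForm O d (fun i => ξ i ω))
      - 8 / squareRate L * t ^ 2 * (2 * weightedForm O (fun i => d i ^ 2) (fun i => ξ i ω)
        + 3 * diagonalForm O (fun i => d i ^ 2) (fun i => ξ i ω))) ≤ 1 := by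
  have h1 := expMoment_weightedForm_sub_le_one h.measurable h.indep (h.hasSubgaussianMGF hL) hO d t
  have ha := squareRate_pos hL
  rw [Real.coe_toNNReal _ (by positivity)] at h1
  convert h1 using 5
  ring

lemma measureReal_chaos_ge_le (h : IsSubgaussianGenerator μ L ξ) (hL : 1 ≤ L)
    (hO : O ∈ Matrix.unitaryGroup (Fin n) 𝕜) (d : Fin n → ℝ) (t s : ℝ) :
    μ.real {ω | s ≤ t * (weightedForm O d (fun i => ξ i ω) - diagonalForm O d (fun i => ξ i ω))
      - 8 / squareRate L * t ^ 2 * (2 * weightedForm O (fun i => d i ^ 2) (fun i => ξ i ω)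
        + 3 * diagonalForm O (fun i => d i ^ 2) (fun i => ξ i ω))} ≤ Real.exp (-s) := by
  have m1 := fun d => h.measurable_comp (measurable_weightedForm O d)
  have m2 := fun d => h.measurable_comp (measurable_diagonalForm O d)
  refine (measureReal_le_of_expMoment_le (c := 0) ?_ ?_).trans (le_of_eq ?_)
  · exact (((m1 d).sub (m2 d)).const_mul t).sub
      ((((m1 _).const_mul 2).add ((m2 _).const_mul 3)).const_mul _)
  · simpa using h.expMoment_chaos_le_one hL hO d t
  · rw [zero_sub]

/-- The small ball estimate for a form of total weight one. The compensator of the self-normalised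
inequality is at most half of the form itself, so that `𝔼 exp (t Z / 2 - 3 t X / 2) ≤ 1` for the form
`X` and its diagonal part `Z`; the Cauchy-Schwarz inequality, in the form `2 x y ≤ θ x² + y² / θ`,
then brings in the lower tail of `Z`. -/
lemma measureReal_weightedForm_le (h : IsSubgaussianGenerator μ L ξ) (hL : 1 ≤ L)
    (hO : O ∈ Matrix.unitaryGroup (Fin n) 𝕜) {d : Fin n → ℝ} (hd : ∀ i, 0 ≤ d i)
    (hd1 : ∑ i, d i = 1) {K B : ℝ} (hK : ∀ i, d i ≤ K) (hB : ∀ k, ∑ i, d i * ‖O i k‖ ^ 2 ≤ B)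
    {t : ℝ} (ht : 0 ≤ t) (htK : t * K ≤ squareRate L / 48) (htB : t * B ≤ squareRate L ^ 2 / 2) :
    μ.real {ω | weightedForm O d (fun i => ξ i ω) ≤ 1 / 12} ≤ Real.exp (-(t / 16)) := by
  have ha := squareRate_pos hL
  set a := squareRate L with hadef
  set X : Ω → ℝ := fun ω => weightedForm O d fun i => ξ i ω with hX
  set Z : Ω → ℝ := fun ω => diagonalForm O d fun i => ξ i ω with hZ
  have mX : Measurable X := h.measurable_comp (measurable_weightedForm O d)
  have mZ : Measurable Z := h.measurable_comp (measurable_diagonalForm O d)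
  have hX0 : ∀ ω, 0 ≤ X ω := fun ω => weightedForm_nonneg O hd _
  have hZ0 : ∀ ω, 0 ≤ Z ω := fun ω => diagonalForm_nonneg O hd _
  have hsq : ∀ i, d i ^ 2 ≤ K * d i + 0 * d i := fun i => by nlinarith [hd i, hK i]
  have hP : expMoment μ (fun ω => -(3 / 2 * t * X ω) + 1 / 2 * t * Z ω) ≤ 1 := by
    refine (expMoment_mono fun ω => ?_).trans (h.expMoment_chaos_le_one hL hO d (-t))
    have q1 := weightedForm_mono O hsq fun i => ξ i ω
    have q2 := diagonalForm_mono O hsq fun i => ξ i ω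
    rw [weightedForm_linear] at q1
    rw [diagonalForm_linear] at q2
    have e1 : 2 * weightedForm O (fun i => d i ^ 2) (fun i => ξ i ω)
        + 3 * diagonalForm O (fun i => d i ^ 2) (fun i => ξ i ω)
        ≤ 3 * K * (X ω + Z ω) := by
      have : 0 ≤ weightedForm O (fun i => d i ^ 2) (fun i => ξ i ω) :=
        weightedForm_nonneg O (fun i => sq_nonneg _) _
      simp only [hX, hZ]
      linarith
    have e2 : 8 / a * (-t) ^ 2 * (2 * weightedForm O (fun i => d i ^ 2) (fun i => ξ i ω)
        + 3 * diagonalForm O (fun i => d i ^ 2) (fun i => ξ i ω))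
        ≤ 1 / 2 * t * (X ω + Z ω) := by
      calc _ ≤ 8 / a * (-t) ^ 2 * (3 * K * (X ω + Z ω)) := by gcongr
        _ = (24 / a * t * (X ω + Z ω)) * (t * K) := by ring
        _ ≤ (24 / a * t * (X ω + Z ω)) * (a / 48) := by
            have := hX0 ω
            have := hZ0 ω
            gcongr
        _ = 1 / 2 * t * (X ω + Z ω) := by field_simp; ring
    change _ ≤ -t * (X ω - Z ω) - _
    linarith
  have hQ : expMoment μ (fun ω => -(1 / 2 * t * Z ω)) ≤ ENNReal.ofReal (Real.exp (-(t / 4))) := by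
    refine (h.expMoment_neg_diagonalForm_le hL hO hd hd1 hB (t := 1 / 2 * t) (by positivity)).trans
      (ENNReal.ofReal_le_ofReal (Real.exp_le_exp.2 ?_))
    have : 2 * (1 / 2 * t) ^ 2 * B / a ^ 2 = t / 2 * (t * B) / a ^ 2 := by ring
    rw [← hadef, this]
    have : t / 2 * (t * B) / a ^ 2 ≤ t / 2 * (a ^ 2 / 2) / a ^ 2 := by gcongr
    have e : t / 2 * (a ^ 2 / 2) / a ^ 2 = t / 4 := by field_simp; norm_num
    linarith
  set θ := Real.exp (-(t / 8)) with hθ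
  have hpt : ∀ ω, ENNReal.ofReal (Real.exp (-(3 / 4 * t * X ω))) ≤
      ENNReal.ofReal (θ / 2) * ENNReal.ofReal (Real.exp (-(3 / 2 * t * X ω) + 1 / 2 * t * Z ω)) +
      ENNReal.ofReal (θ⁻¹ / 2) * ENNReal.ofReal (Real.exp (-(1 / 2 * t * Z ω))) := by
    intro ω
    have hθ0 : 0 < θ := Real.exp_pos _
    rw [← ENNReal.ofReal_mul (by positivity), ← ENNReal.ofReal_mul (by positivity),
      ← ENNReal.ofReal_add (by positivity) (by positivity)]
    apply ENNReal.ofReal_le_ofReal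
    set x := Real.exp ((-(3 / 2 * t * X ω) + 1 / 2 * t * Z ω) / 2 - t / 16) with hx
    set y := Real.exp (-(1 / 2 * t * Z ω) / 2 + t / 16) with hy
    have e0 : Real.exp (-(3 / 4 * t * X ω)) = x * y := by
      rw [hx, hy, ← Real.exp_add]; congr 1; ring
    have e1 : θ * Real.exp (-(3 / 2 * t * X ω) + 1 / 2 * t * Z ω) = x ^ 2 := by
      rw [hx, hθ, ← Real.exp_add, ← Real.exp_nat_mul]; congr 1; push_cast; ring
    have e2 : θ⁻¹ * Real.exp (-(1 / 2 * t * Z ω)) = y ^ 2 := by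
      rw [hy, hθ, ← Real.exp_neg, ← Real.exp_add, ← Real.exp_nat_mul]; congr 1; push_cast; ring
    rw [e0]
    nlinarith [sq_nonneg (x - y)]
  have hE : expMoment μ (fun ω => -(3 / 4 * t * X ω)) ≤ ENNReal.ofReal (Real.exp (-(t / 8))) := by
    refine (lintegral_mono hpt).trans ?_
    rw [lintegral_add_left (by fun_prop), lintegral_const_mul' _ _ ENNReal.ofReal_ne_top,
      lintegral_const_mul' _ _ ENNReal.ofReal_ne_top]
    refine (add_le_add (mul_le_mul_right hP _) (mul_le_mul_right hQ _)).trans ?_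
    have hθ0 : 0 < θ := Real.exp_pos _
    rw [mul_one, ← ENNReal.ofReal_mul (by positivity), ← ENNReal.ofReal_add (by positivity)
      (by positivity)]
    apply ENNReal.ofReal_le_ofReal
    have e : Real.exp (-(t / 4)) = θ * θ := by rw [hθ, ← Real.exp_add]; congr 1; ring
    rw [e, ← hθ]
    have : θ⁻¹ / 2 * (θ * θ) = θ / 2 := by field_simp
    rw [this]
    linarith
  have hfin := measureReal_le_of_expMoment_le (t := -(t / 16)) (by fun_prop) hE
  refine le_trans (measureReal_mono fun ω hω => ?_) (hfin.trans (Real.exp_le_exp.2 (by linarith)))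
  change X ω ≤ 1 / 12 at hω
  change -(t / 16) ≤ -(3 / 4 * t * X ω)
  nlinarith

/-- The expectation of a form is its trace; Markov's inequality. -/
lemma measureReal_weightedForm_ge_le (h : IsSubgaussianGenerator μ L ξ) (hL : 1 ≤ L)
    (hO : O ∈ Matrix.unitaryGroup (Fin n) 𝕜) {d : Fin n → ℝ} (hd : ∀ i, 0 ≤ d i)
    (hd1 : ∑ i, d i = 1) {s : ℝ} (hs : 0 < s) :
    μ.real {ω | s ≤ weightedForm O d (fun i => ξ i ω)} ≤ 1 / s := by
  have hmem : ∀ i, MemLp (ξ i) 2 μ := fun i => by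
    simpa using (h.hasSubgaussianMGF hL i).memLp 2
  have hprod : ∀ j k, Integrable (fun ω => ξ j ω * ξ k ω) μ := fun j k =>
    (hmem j).integrable_mul (hmem k)
  have hcov : ∀ j k, ∫ ω, ξ j ω * ξ k ω ∂μ = if j = k then 1 else 0 := by
    intro j k
    split_ifs with hjk
    · subst hjk
      simpa [sq] using h.integral_sq j
    · rw [(h.indep.indepFun hjk).integral_fun_mul_eq_mul_integral
        (h.measurable j).aestronglyMeasurable (h.measurable k).aestronglyMeasurable,
        h.mean_zero j, zero_mul]
  have hexp : ∀ ω, weightedForm O d (fun i => ξ i ω)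
      = ∑ j, ∑ k, gramWeight O d j k * (ξ j ω * ξ k ω) := by
    intro ω
    rw [weightedForm_eq_sum]
    simp_rw [Finset.mul_sum]
    exact Finset.sum_congr rfl fun j _ => Finset.sum_congr rfl fun k _ => by ring
  have hi : Integrable (fun ω => weightedForm O d (fun i => ξ i ω)) μ := by
    simp_rw [hexp]
    exact integrable_finsetSum _ fun j _ => integrable_finsetSum _ fun k _ =>
      (hprod j k).const_mul _
  have hE : ∫ ω, weightedForm O d (fun i => ξ i ω) ∂μ = 1 := by
    simp_rw [hexp]
    rw [integral_finsetSum _ fun j _ => integrable_finsetSum _ fun k _ => (hprod j k).const_mul _]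
    rw [← hd1]
    have : ∀ j, ∫ ω, ∑ k, gramWeight O d j k * (ξ j ω * ξ k ω) ∂μ = ∑ i, d i * ‖O i j‖ ^ 2 := by
      intro j
      rw [integral_finsetSum _ fun k _ => (hprod j k).const_mul _]
      simp_rw [integral_const_mul, hcov]
      simp [gramWeight_self]
    simp_rw [this]
    rw [Finset.sum_comm]
    refine Finset.sum_congr rfl fun i _ => ?_
    rw [← Finset.mul_sum, sum_norm_sq_row_of_mem_unitaryGroup hO, mul_one]
  have := mul_meas_ge_le_integral_of_nonneg (μ := μ)
    (Filter.Eventually.of_forall fun ω => weightedForm_nonneg O hd fun i => ξ i ω) hi s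
  rw [hE] at this
  rw [le_div_iff₀ hs, mul_comm]
  exact this

end IsSubgaussianGenerator

/-! ### The transform of a sparse vector and the small ball estimate -/

section Weights

variable {𝕜 : Type w} [RCLike 𝕜] {n r : ℕ} {β : ℝ}

/-- The weights `|(W v)ᵢ|²`. -/
noncomputable def transformWeight (W : Matrix (Fin n) (Fin n) 𝕜) (v : EuclideanSpace ℝ (Fin n))
    (i : Fin n) : ℝ :=
  ‖W.mulVec (fun j => ((v j : ℝ) : 𝕜)) i‖ ^ 2

lemma transformWeight_nonneg (W : Matrix (Fin n) (Fin n) 𝕜) (v : EuclideanSpace ℝ (Fin n))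
    (i : Fin n) : 0 ≤ transformWeight W v i := sq_nonneg _

lemma sum_transformWeight {W : Matrix (Fin n) (Fin n) 𝕜} (hW : W ∈ Matrix.unitaryGroup (Fin n) 𝕜)
    {v : EuclideanSpace ℝ (Fin n)} (hv : v ∈ sparseSphere n r) :
    ∑ i, transformWeight W v i = 1 := by
  unfold transformWeight
  rw [sum_norm_sq_mulVec_of_mem_unitaryGroup hW]
  have h : ‖v‖ ^ 2 = 1 := by rw [hv.1, one_pow]
  rw [EuclideanSpace.norm_sq_eq] at h
  simpa using h

lemma sum_abs_le_of_mem_sparseSphere {v : EuclideanSpace ℝ (Fin n)} (hv : v ∈ sparseSphere n r) :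
    ∑ i, |v i| ≤ √(r : ℝ) := by
  have h : ‖v‖ ^ 2 = 1 := by rw [hv.1, one_pow]
  rw [EuclideanSpace.norm_sq_eq] at h
  simp only [Real.norm_eq_abs, sq_abs] at h
  have e1 : ∑ i, |v i| = ∑ i ∈ Finset.univ.filter fun i => v i ≠ 0, |v i| := by
    refine (Finset.sum_subset (Finset.subset_univ _) fun i _ hi => ?_).symm
    simpa using hi
  rw [e1]
  apply Real.le_sqrt_of_sq_le
  refine sq_sum_le_card_mul_sum_sq.trans ?_
  have h2 : ∑ i ∈ Finset.univ.filter fun i => v i ≠ 0, |v i| ^ 2 ≤ 1 := by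
    rw [← h]
    simp_rw [sq_abs]
    exact Finset.sum_le_univ_sum_of_nonneg fun i => sq_nonneg _
  have h3 : (((Finset.univ.filter fun i => v i ≠ 0).card : ℕ) : ℝ) ≤ r := by exact_mod_cast hv.2
  calc _ ≤ (r : ℝ) * 1 := by gcongr
    _ = r := mul_one _

lemma norm_mulVec_le {W : Matrix (Fin n) (Fin n) 𝕜} {κ : ℝ}
    (hW : ∀ i j, ‖W i j‖ ≤ κ) (x : Fin n → ℝ) (i : Fin n) :
    ‖W.mulVec (fun j => ((x j : ℝ) : 𝕜)) i‖ ≤ κ * ∑ j, |x j| := by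
  rw [Matrix.mulVec, dotProduct, Finset.mul_sum]
  refine (norm_sum_le _ _).trans (Finset.sum_le_sum fun j _ => ?_)
  rw [norm_mul, RCLike.norm_ofReal]
  exact mul_le_mul_of_nonneg_right (hW i j) (abs_nonneg _)

lemma transformWeight_le {W : Matrix (Fin n) (Fin n) 𝕜} (hβ : 0 ≤ β) (hW : IsHadamardType β W)
    {v : EuclideanSpace ℝ (Fin n)} (hv : v ∈ sparseSphere n r) (i : Fin n) :
    transformWeight W v i ≤ β ^ 2 * r / n := by
  unfold transformWeight
  have h1 := norm_mulVec_le hW.2 (fun j => v j) i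
  have h2 : ‖W.mulVec (fun j => ((v j : ℝ) : 𝕜)) i‖ ≤ β / √(n : ℝ) * √(r : ℝ) :=
    h1.trans (mul_le_mul_of_nonneg_left (sum_abs_le_of_mem_sparseSphere hv) (by positivity))
  calc _ ≤ (β / √(n : ℝ) * √(r : ℝ)) ^ 2 := by gcongr
    _ = β ^ 2 * r / n := by
      rw [mul_pow, div_pow, Real.sq_sqrt (by positivity), Real.sq_sqrt (by positivity)]; ring

lemma sum_mul_norm_sq_le {O : Matrix (Fin n) (Fin n) 𝕜} (hO : IsHadamardType β O)
    {d : Fin n → ℝ} (hd : ∀ i, 0 ≤ d i) (hd1 : ∑ i, d i = 1) (k : Fin n) :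
    ∑ i, d i * ‖O i k‖ ^ 2 ≤ β ^ 2 / n := by
  calc ∑ i, d i * ‖O i k‖ ^ 2 ≤ ∑ i, d i * (β ^ 2 / n) := by
        refine Finset.sum_le_sum fun i _ => mul_le_mul_of_nonneg_left ?_ (hd i)
        calc ‖O i k‖ ^ 2 ≤ (β / √(n : ℝ)) ^ 2 := by gcongr; exact hO.2 i k
          _ = β ^ 2 / n := by rw [div_pow, Real.sq_sqrt (by positivity)]
    _ = β ^ 2 / n := by rw [← Finset.sum_mul, hd1, one_mul]

lemma normMulVec_gammaMatrix {U : Matrix (Fin n) (Fin n) 𝕜}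
    (hU : U ∈ Matrix.unitaryGroup (Fin n) 𝕜) (W O : Matrix (Fin n) (Fin n) 𝕜)
    (v : EuclideanSpace ℝ (Fin n)) (x : Fin n → ℝ) :
    normMulVec (gammaMatrix U W O v) x = √(n : ℝ) * √(weightedForm O (transformWeight W v) x) := by
  unfold normMulVec gammaMatrix
  rw [EuclideanSpace.norm_eq, ← Real.sqrt_mul (by positivity)]
  congr 1
  simp only [Matrix.smul_mulVec, Pi.smul_apply, smul_eq_mul, norm_mul, mul_pow,
    RCLike.norm_ofReal, sq_abs]
  rw [← Finset.mul_sum, Real.sq_sqrt (by positivity)]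
  congr 1
  rw [← Matrix.mulVec_mulVec, ← Matrix.mulVec_mulVec, sum_norm_sq_mulVec_of_mem_unitaryGroup hU]
  unfold weightedForm transformWeight
  exact Finset.sum_congr rfl fun i _ => by rw [Matrix.mulVec_diagonal, norm_mul, mul_pow]

/-- The small ball estimate for a single `v`, with `κ₁ = 1/4`: the exponential Markov inequality for
`weightedForm` at a parameter `t` proportional to `n / (β² r)`, the largest order that the bound
`β² r / n` on the weights permits. -/
theorem exists_isSmallBallPair (𝕜 : Type w) [RCLike 𝕜] {L β : ℝ} (hL : 1 ≤ L) (hβ : 1 ≤ β) :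
    ∃ κ₁ κ₂ : ℝ, IsSmallBallPair.{u, w} 𝕜 L β κ₁ κ₂ := by
  have ha := squareRate_pos hL
  set a := squareRate L with had
  set c := min (a / 48) (a ^ 2 / 2) with hc
  have hc0 : 0 < c := lt_min (by positivity) (by positivity)
  refine ⟨1 / 4, c / (16 * β ^ 2), by norm_num, by positivity, ?_⟩
  intro n r hr hrn U W O hU hW hO Ω _ μ _ ξ h v hv
  have hr0 : (0 : ℝ) < r := by exact_mod_cast hr
  have hr1 : (1 : ℝ) ≤ r := by exact_mod_cast hr
  have hn0 : (0 : ℝ) < n := hr0.trans_le (by exact_mod_cast hrn)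
  have hβ0 : 0 < β := by linarith
  have hd1 := sum_transformWeight hW.1 hv
  have hd := transformWeight_nonneg W v
  have key := h.measureReal_weightedForm_le hL hO.1 hd hd1
    (transformWeight_le hβ0.le hW hv) (sum_mul_norm_sq_le hO hd hd1)
    (t := c * n / (β ^ 2 * r)) (by positivity)
    (by
      have : c * n / (β ^ 2 * r) * (β ^ 2 * r / n) = c := by field_simp
      rw [this]; exact min_le_left _ _)
    (by
      have : c * n / (β ^ 2 * r) * (β ^ 2 / n) = c / r := by field_simp
      rw [this]
      exact (div_le_self hc0.le hr1).trans (min_le_right _ _))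
  refine le_trans (measureReal_mono fun ω hω => ?_) (key.trans ?_)
  · change normMulVec _ _ ≤ _ at hω
    rw [normMulVec_gammaMatrix hU.1, hv.1, mul_one, mul_comm (1 / 4 : ℝ)] at hω
    have h1 := le_of_mul_le_mul_left hω (Real.sqrt_pos.2 hn0)
    rw [Real.sqrt_le_left (by norm_num)] at h1
    change weightedForm O _ _ ≤ 1 / 12
    linarith
  · rw [Real.rpow_def_of_pos (by norm_num)]
    apply Real.exp_le_exp.2
    rw [one_div, Real.log_inv]
    have e : c * n / (β ^ 2 * r) / 16 = c / (16 * β ^ 2) * n / r := by field_simp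
    rw [e]
    have h2 : 0 ≤ c / (16 * β ^ 2) * n / r := by positivity
    nlinarith [Real.log_two_lt_d9]

end Weights

/-! ### Maurey's empirical method -/

section Maurey

variable {ι κ : Type*} [Fintype ι] [Fintype κ]

/-- Hoeffding's lemma for a finitely supported distribution. -/
lemma sum_mul_exp_le_of_abs_le {p y : ι → ℝ} (hp : ∀ j, 0 ≤ p j) (hp1 : ∑ j, p j = 1)
    {c : ℝ} (hc : 0 < c) (hy : ∀ j, |y j| ≤ c) (hy0 : ∑ j, p j * y j = 0) (θ : ℝ) :
    ∑ j, p j * Real.exp (θ * y j) ≤ Real.exp ((θ * c) ^ 2 / 2) := by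
  have h1 : ∀ j, Real.exp (θ * y j) ≤ Real.cosh (θ * c) + y j / c * Real.sinh (θ * c) := by
    intro j
    have h := convexOn_exp.2 (Set.mem_univ (θ * c)) (Set.mem_univ (-(θ * c)))
      (show 0 ≤ (c + y j) / (2 * c) from
        div_nonneg (by linarith [(abs_le.1 (hy j)).1]) (by positivity))
      (show 0 ≤ (c - y j) / (2 * c) from
        div_nonneg (by linarith [(abs_le.1 (hy j)).2]) (by positivity))
      (by field_simp; ring)
    simp only [smul_eq_mul] at h
    have e1 : (c + y j) / (2 * c) * (θ * c) + (c - y j) / (2 * c) * -(θ * c) = θ * y j := by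
      field_simp; ring
    rw [e1] at h
    refine h.trans (le_of_eq ?_)
    rw [Real.cosh_eq, Real.sinh_eq]
    field_simp
    ring
  calc ∑ j, p j * Real.exp (θ * y j)
      ≤ ∑ j, p j * (Real.cosh (θ * c) + y j / c * Real.sinh (θ * c)) :=
        Finset.sum_le_sum fun j _ => mul_le_mul_of_nonneg_left (h1 j) (hp j)
    _ = (∑ j, p j) * Real.cosh (θ * c) + (∑ j, p j * y j) * (Real.sinh (θ * c) / c) := by
        rw [Finset.sum_mul, Finset.sum_mul, ← Finset.sum_add_distrib]
        exact Finset.sum_congr rfl fun j _ => by ring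
    _ = Real.cosh (θ * c) := by rw [hp1, hy0]; ring
    _ ≤ _ := Real.cosh_le_exp_half_sq _

lemma exists_le_of_sum_mul_le {p g : ι → ℝ} (hp : ∀ j, 0 ≤ p j) (hp1 : ∑ j, p j = 1) {C : ℝ}
    (h : ∑ j, p j * g j ≤ C) : ∃ j, g j ≤ C := by
  by_contra! hc
  have h1 : ∑ j, p j * (g j - C) ≤ 0 := by
    simp_rw [mul_sub]
    rw [Finset.sum_sub_distrib, ← Finset.sum_mul, hp1]
    linarith
  have h2 : ∀ j ∈ Finset.univ, 0 ≤ p j * (g j - C) := fun j _ =>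
    mul_nonneg (hp j) (by linarith [hc j])
  have h3 := (Finset.sum_eq_zero_iff_of_nonneg h2).1 (le_antisymm h1 (Finset.sum_nonneg h2))
  have h4 : ∀ j, p j = 0 := fun j => by
    rcases mul_eq_zero.1 (h3 j (Finset.mem_univ j)) with h | h
    · exact h
    · linarith [hc j]
  simp [h4] at hp1

/-- The greedy form of the empirical method: among the points one can always choose the next one so
that the potential `∑ₖ cosh (θ Sₖ)` of the partial sums grows at most by the average factor. -/
lemma exists_sum_cosh_le {p : ι → ℝ} (hp : ∀ j, 0 ≤ p j) (hp1 : ∑ j, p j = 1)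
    {y : ι → κ → ℝ} {c : ℝ} (hc : 0 < c) (hy : ∀ j k, |y j k| ≤ c)
    (hy0 : ∀ k, ∑ j, p j * y j k = 0) (θ : ℝ) (m : ℕ) :
    ∃ f : Fin m → ι, ∑ k, Real.cosh (θ * ∑ l, y (f l) k) ≤
      Fintype.card κ * Real.exp (m * ((θ * c) ^ 2 / 2)) := by
  induction m with
  | zero => exact ⟨Fin.elim0, by simp⟩
  | succ m ih =>
    obtain ⟨f, hf⟩ := ih
    have step : ∀ (k : κ) (u : ℝ), ∑ j, p j * Real.cosh (θ * (y j k + u)) ≤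
        Real.exp ((θ * c) ^ 2 / 2) * Real.cosh (θ * u) := by
      intro k u
      have h1 := sum_mul_exp_le_of_abs_le hp hp1 hc (fun j => hy j k) (hy0 k) θ
      have h2 := sum_mul_exp_le_of_abs_le hp hp1 hc (fun j => hy j k) (hy0 k) (-θ)
      rw [neg_mul, neg_sq] at h2
      calc ∑ j, p j * Real.cosh (θ * (y j k + u))
          = (Real.exp (θ * u) * ∑ j, p j * Real.exp (θ * y j k)
            + Real.exp (-(θ * u)) * ∑ j, p j * Real.exp (-θ * y j k)) / 2 := by
            rw [Finset.mul_sum, Finset.mul_sum, ← Finset.sum_add_distrib, Finset.sum_div]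
            refine Finset.sum_congr rfl fun j _ => ?_
            rw [Real.cosh_eq, mul_add, neg_add, Real.exp_add, Real.exp_add, neg_mul]
            ring
        _ ≤ (Real.exp (θ * u) * Real.exp ((θ * c) ^ 2 / 2)
            + Real.exp (-(θ * u)) * Real.exp ((θ * c) ^ 2 / 2)) / 2 := by gcongr
        _ = _ := by rw [Real.cosh_eq]; ring
    have key : ∑ j, p j * ∑ k, Real.cosh (θ * (y j k + ∑ l, y (f l) k)) ≤
        Real.exp ((θ * c) ^ 2 / 2) * ∑ k, Real.cosh (θ * ∑ l, y (f l) k) := by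
      rw [Finset.mul_sum]
      simp_rw [fun j => Finset.mul_sum Finset.univ
        (fun k => Real.cosh (θ * (y j k + ∑ l, y (f l) k))) (p j)]
      rw [Finset.sum_comm]
      exact Finset.sum_le_sum fun k _ => step k _
    obtain ⟨j, hj⟩ := exists_le_of_sum_mul_le hp hp1 key
    refine ⟨Fin.cons j f, ?_⟩
    simp_rw [Fin.sum_univ_succ, Fin.cons_zero, Fin.cons_succ]
    refine hj.trans ?_
    calc _ ≤ Real.exp ((θ * c) ^ 2 / 2) * (Fintype.card κ * Real.exp (m * ((θ * c) ^ 2 / 2))) := by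
          gcongr
      _ = _ := by
          push_cast
          rw [add_mul, Real.exp_add, one_mul]; ring

lemma exists_abs_sum_le [Nonempty κ] {p : ι → ℝ} (hp : ∀ j, 0 ≤ p j) (hp1 : ∑ j, p j = 1)
    {y : ι → κ → ℝ} {c : ℝ} (hc : 0 < c) (hy : ∀ j k, |y j k| ≤ c)
    (hy0 : ∀ k, ∑ j, p j * y j k = 0) {m : ℕ} (hm : 0 < m) :
    ∃ f : Fin m → ι, ∀ k, |∑ l, y (f l) k| ≤ m * (c * √(2 * Real.log (2 * Fintype.card κ) / m)) := by
  have hm0 : (0 : ℝ) < m := by exact_mod_cast hm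
  have hK : (1 : ℝ) ≤ Fintype.card κ := by exact_mod_cast Fintype.card_pos
  have hl : 0 < Real.log (2 * Fintype.card κ) := Real.log_pos (by linarith)
  -- this value of `θ` balances `log (2 K) / θ` and `m θ c² / 2`
  set q := √(2 * Real.log (2 * Fintype.card κ) / m) with hq
  have hq0 : 0 < q := Real.sqrt_pos.2 (by positivity)
  have hq2 : q ^ 2 = 2 * Real.log (2 * Fintype.card κ) / m := Real.sq_sqrt (by positivity)
  obtain ⟨f, hf⟩ := exists_sum_cosh_le hp hp1 hc hy hy0 (q / c) m
  refine ⟨f, fun k => ?_⟩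
  have h1 : Real.exp |q / c * ∑ l, y (f l) k| / 2 ≤ Real.cosh (q / c * ∑ l, y (f l) k) := by
    rw [← Real.cosh_abs, Real.cosh_eq]
    linarith [Real.exp_pos (-|q / c * ∑ l, y (f l) k|)]
  have h2 := Finset.single_le_sum (f := fun k => Real.cosh (q / c * ∑ l, y (f l) k))
    (fun i _ => (Real.cosh_pos _).le) (Finset.mem_univ k)
  have h3 : Real.exp |q / c * ∑ l, y (f l) k| ≤
      Real.exp (Real.log (2 * Fintype.card κ) + m * ((q / c * c) ^ 2 / 2)) := by
    rw [Real.exp_add, Real.exp_log (by positivity)]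
    linarith
  have h4 := Real.exp_le_exp.1 h3
  have e1 : (q / c * c) ^ 2 = q ^ 2 := by field_simp
  have e2 : Real.log (2 * Fintype.card κ) = m * q ^ 2 / 2 := by rw [hq2]; field_simp
  rw [e1, e2, abs_mul, abs_of_pos (by positivity : 0 < q / c)] at h4
  have h5 : q / c * |∑ l, y (f l) k| ≤ q / c * (m * (c * q)) := by
    refine h4.trans (le_of_eq ?_)
    field_simp; ring
  exact le_of_mul_le_mul_left h5 (by positivity)

end Maurey

section Net

variable {𝕜 : Type w} [RCLike 𝕜] {n r : ℕ} {β : ℝ}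

/-- The sign of a Boolean. -/
noncomputable def boolSign (s : Bool) : ℝ := if s then 1 else -1

/-- The image under `W` of the average of the points `± √r e_j` listed by `f`. -/
noncomputable def netCenter (r : ℕ) (W : Matrix (Fin n) (Fin n) 𝕜) {m : ℕ}
    (f : Fin m → Fin n × Bool) (i : Fin n) : 𝕜 :=
  (m : 𝕜)⁻¹ * ∑ l, ((boolSign (f l).2 * √(r : ℝ) : ℝ) : 𝕜) * W i (f l).1

/-- Maurey's empirical method: a point of the sparse sphere lies in `√r` times the cross-polytope,
so that `W v` is approximated in the maximum norm by averages of `m` scaled signed columns of `W`. -/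
lemma exists_netCenter_near (hβ : 0 < β) (hr : 1 ≤ r) (hn : 1 ≤ n) {W : Matrix (Fin n) (Fin n) 𝕜}
    (hW : IsHadamardType β W) {v : EuclideanSpace ℝ (Fin n)} (hv : v ∈ sparseSphere n r)
    {m : ℕ} (hm : 0 < m) :
    ∃ f : Fin m → Fin n × Bool, ∀ i,
      ‖W.mulVec (fun j => ((v j : ℝ) : 𝕜)) i - netCenter r W f i‖ ≤
        6 * (β * √((r : ℝ) / n)) * √(Real.log (4 * n) / m) := by
  have hr0 : (0 : ℝ) < r := by exact_mod_cast hr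
  have hn0 : (0 : ℝ) < n := by exact_mod_cast hn
  have hm0 : (0 : ℝ) < m := by exact_mod_cast hm
  have hne : Nonempty (Fin n) := ⟨⟨0, hn⟩⟩
  set R := √(r : ℝ) with hR
  have hR0 : 0 < R := Real.sqrt_pos.2 hr0
  set b := β * √((r : ℝ) / n) with hb
  have hb0 : 0 < b := by positivity
  have hbR : β / √(n : ℝ) * R = b := by
    rw [hb, Real.sqrt_div hr0.le]; ring
  set s1 := ∑ j, |v j| with hs1
  have hs1R : s1 ≤ R := sum_abs_le_of_mem_sparseSphere hv
  let w : Fin n → 𝕜 := W.mulVec fun j => ((v j : ℝ) : 𝕜)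
  have hw : ∀ i, ‖w i‖ ≤ b := fun i => by
    have := (norm_mulVec_le hW.2 (fun j => v j) i).trans
      (mul_le_mul_of_nonneg_left hs1R (by positivity))
    rwa [hbR] at this
  -- the barycentric coordinates of `v`; the mass missing from `‖v‖₁ / √r` is spread evenly
  let p : Fin n × Bool → ℝ := fun z =>
    (|v z.1| + boolSign z.2 * v z.1) / (2 * R) + (1 - s1 / R) / (2 * n)
  have hp : ∀ z, 0 ≤ p z := by
    rintro ⟨j, s⟩
    have h1 : 0 ≤ 1 - s1 / R := by rw [sub_nonneg, div_le_one hR0]; exact hs1R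
    have h2 : 0 ≤ |v j| + boolSign s * v j := by
      unfold boolSign
      split_ifs
      · linarith [neg_abs_le (v j)]
      · linarith [le_abs_self (v j)]
    exact add_nonneg (div_nonneg h2 (by positivity)) (div_nonneg h1 (by positivity))
  have hp1 : ∑ z, p z = 1 := by
    rw [Fintype.sum_prod_type]
    have : ∀ j, ∑ s, p (j, s) = |v j| / R + (1 - s1 / R) / n := by
      intro j
      simp only [Fintype.sum_bool, p, boolSign, if_true, Bool.false_eq_true, if_false]
      field_simp; ring
    simp_rw [this]
    rw [Finset.sum_add_distrib, ← Finset.sum_div, ← hs1]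
    simp; field_simp; ring
  let φ : Bool → 𝕜 → ℝ := fun s z => if s then RCLike.re z else RCLike.im z
  have hφ : ∀ s z, |φ s z| ≤ ‖z‖ := by
    intro s z
    cases s
    · exact RCLike.abs_im_le_norm z
    · exact RCLike.abs_re_le_norm z
  have hφadd : ∀ s (x z : 𝕜), φ s (x - z) = φ s x - φ s z := by
    intro s x z; cases s <;> simp [φ]
  have hφmul : ∀ s (x : ℝ) (z : 𝕜), φ s ((x : 𝕜) * z) = x * φ s z := by
    intro s x z; cases s <;> simp [φ]
  have hφsum : ∀ s {τ : Type} (T : Finset τ) (g : τ → 𝕜), φ s (∑ l ∈ T, g l) = ∑ l ∈ T, φ s (g l) := by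
    intro s τ T g; cases s <;> simp [φ]
  let y : Fin n × Bool → Fin n × Bool → ℝ := fun z k =>
    boolSign z.2 * R * φ k.2 (W k.1 z.1) - φ k.2 (w k.1)
  have hsign : ∀ s, |boolSign s| = 1 := by intro s; cases s <;> simp [boolSign]
  have hy : ∀ z k, |y z k| ≤ 2 * b := by
    intro z k
    have h1 : |boolSign z.2 * R * φ k.2 (W k.1 z.1)| ≤ b := by
      rw [abs_mul, abs_mul, hsign, one_mul, abs_of_pos hR0, ← hbR, mul_comm]
      exact mul_le_mul_of_nonneg_right ((hφ _ _).trans (hW.2 _ _)) hR0.le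
    have h2 : |φ k.2 (w k.1)| ≤ b := (hφ _ _).trans (hw _)
    exact (abs_sub _ _).trans (by linarith)
  have hy0 : ∀ k, ∑ z, p z * y z k = 0 := by
    intro k
    have e1 : ∑ z, p z * y z k = ∑ z, p z * (boolSign z.2 * R * φ k.2 (W k.1 z.1))
        - φ k.2 (w k.1) := by
      simp only [y, mul_sub]
      rw [Finset.sum_sub_distrib, ← Finset.sum_mul, hp1, one_mul]
    rw [e1, Fintype.sum_prod_type]
    have e2 : φ k.2 (w k.1) = ∑ j, v j * φ k.2 (W k.1 j) := by
      simp only [w, Matrix.mulVec, dotProduct]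
      rw [hφsum]
      refine Finset.sum_congr rfl fun j _ => ?_
      rw [mul_comm, hφmul]
    rw [e2, sub_eq_zero]
    refine Finset.sum_congr rfl fun j _ => ?_
    simp only [Fintype.sum_bool, p, boolSign]
    simp
    field_simp
    ring
  have : Nonempty (Fin n × Bool) := ⟨(⟨0, hn⟩, true)⟩
  obtain ⟨f, hf⟩ := exists_abs_sum_le hp hp1 (by positivity : 0 < 2 * b) hy hy0 hm
  refine ⟨f, fun i => ?_⟩
  have hcomp : ∀ s, |φ s (w i - netCenter r W f i)| ≤ 2 * b * √(2 * Real.log (4 * n) / m) := by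
    intro s
    have h1 := hf (i, s)
    have e1 : ∑ l, y (f l) (i, s) = -(m * φ s (w i - netCenter r W f i)) := by
      have e3 : netCenter r W f i = (((m : ℝ)⁻¹ : ℝ) : 𝕜) *
          ∑ l, ((boolSign (f l).2 * √(r : ℝ) : ℝ) : 𝕜) * W i (f l).1 := by
        simp [netCenter]
      rw [hφadd, e3, hφmul, hφsum]
      simp_rw [hφmul]
      simp only [y]
      rw [Finset.sum_sub_distrib]
      simp
      field_simp
      ring
    have e2 : (2 * (Fintype.card (Fin n × Bool) : ℝ)) = 4 * n := by
      simp; ring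
    rw [e1, abs_neg, abs_mul, abs_of_pos hm0, e2] at h1
    exact le_of_mul_le_mul_left h1 hm0
  have h3 := hcomp true
  have h4 := hcomp false
  simp only [φ, if_true, Bool.false_eq_true, if_false] at h3 h4
  have h5 : √(2 * Real.log (4 * n) / m) = √2 * √(Real.log (4 * n) / m) := by
    rw [mul_div_assoc, Real.sqrt_mul (by norm_num)]
  have h6 : √2 ≤ 3 / 2 := by
    rw [Real.sqrt_le_left (by norm_num)]; norm_num
  have h7 : ∀ z : 𝕜, ‖z‖ ≤ |RCLike.re z| + |RCLike.im z| := by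
    intro z
    rw [← pow_le_pow_iff_left₀ (norm_nonneg z) (by positivity) two_ne_zero,
      RCLike.norm_sq_eq_def, add_sq, sq_abs, sq_abs]
    nlinarith [mul_nonneg (abs_nonneg (RCLike.re z)) (abs_nonneg (RCLike.im z))]
  refine (h7 (w i - netCenter r W f i)).trans ((add_le_add h3 h4).trans ?_)
  rw [h5]
  calc 2 * b * (√2 * √(Real.log (4 * n) / m)) + 2 * b * (√2 * √(Real.log (4 * n) / m))
      = 4 * √2 * b * √(Real.log (4 * n) / m) := by ring
    _ ≤ 6 * b * √(Real.log (4 * n) / m) := by gcongr; linarith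

end Net

/-! ### Chaining -/

section Chain

/-- The exponent of the self-normalised inequality, for the weights `d` at the point `x`. -/
noncomputable def chaosExcess {𝕜 : Type w} [RCLike 𝕜] {n : ℕ} (a : ℝ)
    (O : Matrix (Fin n) (Fin n) 𝕜) (d x : Fin n → ℝ) (t : ℝ) : ℝ :=
  t * (weightedForm O d x - diagonalForm O d x)
    - 8 / a * t ^ 2 * (2 * weightedForm O (fun i => d i ^ 2) x
      + 3 * diagonalForm O (fun i => d i ^ 2) x)

lemma abs_sub_le_of_chaosExcess_lt {𝕜 : Type w} [RCLike 𝕜] {n : ℕ} {a : ℝ} (ha : 0 < a)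
    {O : Matrix (Fin n) (Fin n) 𝕜} {d x : Fin n → ℝ} {s δ Q : ℝ} (hs : 0 < s) (hδ : 0 < δ)
    (hQ : 2 * weightedForm O (fun i => d i ^ 2) x + 3 * diagonalForm O (fun i => d i ^ 2) x
      ≤ δ ^ 2 * Q)
    (h1 : chaosExcess a O d x (√s / δ) < s) (h2 : chaosExcess a O d x (-(√s / δ)) < s) :
    |weightedForm O d x - diagonalForm O d x| ≤ √s * δ * (1 + 8 / a * Q) := by
  unfold chaosExcess at h1 h2
  set Y := weightedForm O d x - diagonalForm O d x
  set q := 2 * weightedForm O (fun i => d i ^ 2) x + 3 * diagonalForm O (fun i => d i ^ 2) x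
  have hr : 0 < √s := Real.sqrt_pos.2 hs
  have hτ : 0 < √s / δ := by positivity
  have hss : √s ^ 2 = s := Real.sq_sqrt hs.le
  have hb : 8 / a * (√s / δ) ^ 2 * q ≤ 8 / a * s * Q := by
    calc _ ≤ 8 / a * (√s / δ) ^ 2 * (δ ^ 2 * Q) := by gcongr
      _ = _ := by rw [div_pow, hss]; field_simp
  have h3 : √s / δ * |Y| ≤ s * (1 + 8 / a * Q) := by
    rw [neg_sq] at h2
    rcases abs_cases Y with h | h <;> rw [h.1] <;> linarith
  have h4 : √s / δ * |Y| ≤ √s / δ * (√s * δ * (1 + 8 / a * Q)) := by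
    have e : √s / δ * (√s * δ * (1 + 8 / a * Q)) = √s ^ 2 * (1 + 8 / a * Q) := by field_simp
    rwa [e, hss]
  exact le_of_mul_le_mul_left h4 hτ

/-- The deterministic part of the chaining argument. The bounds for the increments of `X - Z` are
allowed to depend linearly on the unknown maximum `M` of `X`; since their coefficients are small,
the resulting inequality for `M` bounds it, and with it the increments. -/
lemma le_of_chain {E : Type*} {V : Finset E} {X Z : E → ℝ} {P : ℕ → E → E} {K : ℕ} {a C : ℝ}
    (ha : 0 < a) (hC : 0 ≤ C) (hPK : ∀ v ∈ V, P K v = v) {ε₀ ε : ℝ} (hε₀ : 0 ≤ ε₀)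
    (hε : 0 ≤ ε) (hZl : ∀ v ∈ V, 3 / 4 ≤ Z v) (hZu : ∀ v ∈ V, Z v ≤ C)
    (hbase : ∀ M, (∀ v ∈ V, X v ≤ M) → ∀ v ∈ V,
      |X (P 0 v) - Z (P 0 v)| ≤ ε₀ * (1 + 32 / a * (2 * M + 3 * C)))
    (hlink : ∀ M, (∀ v ∈ V, X v ≤ M) → ∀ k < K, ∀ v ∈ V,
      |(X (P (k + 1) v) - Z (P (k + 1) v)) - (X (P k v) - Z (P k v))|
        ≤ ε * (1 + 32 / a * (2 * M + 3 * C)))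
    (hsmall : (ε₀ + K * ε) * (8 * (1 + 128 / a + 224 * C / a)) ≤ 1)
    {v : E} (hv : v ∈ V) : 5 / 8 ≤ X v := by
  obtain ⟨v₀, hv₀, hmax⟩ := V.exists_max_image X ⟨v, hv⟩
  set M := X v₀
  set η := ε₀ + K * ε with hη
  have hη0 : 0 ≤ η := by positivity
  set G := 1 + 32 / a * (2 * M + 3 * C) with hG
  have hY : ∀ v ∈ V, |X v - Z v| ≤ η * G := by
    intro v hv
    have hk : ∀ k ≤ K, |X (P k v) - Z (P k v)| ≤ (ε₀ + k * ε) * G := by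
      intro k
      induction k with
      | zero => intro _; simpa using hbase M hmax v hv
      | succ k ih =>
        intro hk
        have h1 := ih (by omega)
        have h2 := hlink M hmax k (by omega) v hv
        have h3 := abs_add_le ((X (P (k + 1) v) - Z (P (k + 1) v)) - (X (P k v) - Z (P k v)))
          (X (P k v) - Z (P k v))
        rw [sub_add_cancel] at h3
        push_cast
        linarith
    have := hk K le_rfl
    rwa [hPK v hv] at this
  have hM := hY v₀ hv₀
  have hM1 := (abs_le.1 hM).2
  have hZ0 := hZu v₀ hv₀
  have ha' : 0 < 1 / a := by positivity
  have e1 : η * G = η + 64 * (η * (1 / a)) * M + 96 * (η * (1 / a)) * C := by rw [hG]; ring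
  have e2 : η * (8 * (1 + 128 / a + 224 * C / a))
      = 8 * η + 1024 * (η * (1 / a)) + 1792 * (η * (1 / a)) * C := by ring
  rw [e2] at hsmall
  set ζ := η * (1 / a) with hζ
  have hζ0 : 0 ≤ ζ := by positivity
  have hζC : 0 ≤ ζ * C := by positivity
  have hM0 : 0 ≤ M := by
    by_contra hneg
    push Not at hneg
    have hz := hZl v₀ hv₀
    have h0 := (abs_le.1 hM).1
    rw [e1] at h0
    have : ζ * M ≤ 0 := mul_nonpos_of_nonneg_of_nonpos hζ0 hneg.le
    nlinarith
  have hM2 : M ≤ 2 * C + 2 := by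
    rw [e1] at hM1
    have : ζ * M ≤ 1 / 1024 * M := by gcongr; linarith
    change M - Z v₀ ≤ _ at hM1
    linarith
  have hfin := (abs_le.1 (hY v hv)).1
  have hz := hZl v hv
  rw [e1] at hfin
  have : ζ * M ≤ ζ * (2 * C + 2) := by gcongr
  linarith

variable {𝕜 : Type w} [RCLike 𝕜] {n r : ℕ} {β : ℝ}

/-- Every finite subset of the sparse sphere is covered, in the maximum norm of the transform, by a
small number of its own points. -/
lemma exists_projection (hβ : 0 < β) (hr : 1 ≤ r) (hn : 1 ≤ n) {W : Matrix (Fin n) (Fin n) 𝕜}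
    (hW : IsHadamardType β W) {V : Finset (EuclideanSpace ℝ (Fin n))}
    (hV : ↑V ⊆ sparseSphere n r) {m : ℕ} (hm : 0 < m) :
    ∃ P : EuclideanSpace ℝ (Fin n) → EuclideanSpace ℝ (Fin n), (∀ v ∈ V, P v ∈ V) ∧
      (∃ T : Finset (EuclideanSpace ℝ (Fin n)), (∀ v ∈ V, P v ∈ T) ∧ T.card ≤ (2 * n) ^ m) ∧
      ∀ v ∈ V, ∀ i, ‖W.mulVec (fun j => ((v j : ℝ) : 𝕜)) i
          - W.mulVec (fun j => ((P v j : ℝ) : 𝕜)) i‖ ≤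
        12 * (β * √((r : ℝ) / n)) * √(Real.log (4 * n) / m) := by
  classical
  have : Nonempty (Fin n) := ⟨⟨0, hn⟩⟩
  choose! F hF using fun v (hv : v ∈ V) => exists_netCenter_near hβ hr hn hW (hV hv) hm
  let g := Function.invFunOn F (V : Set (EuclideanSpace ℝ (Fin n)))
  have hmem : ∀ v ∈ V, F v ∈ F '' (V : Set (EuclideanSpace ℝ (Fin n))) := fun v hv =>
    Set.mem_image_of_mem F hv
  refine ⟨fun v => g (F v), fun v hv => ?_, ⟨Finset.univ.image g, fun v _ => ?_, ?_⟩,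
    fun v hv i => ?_⟩
  · exact Function.invFunOn_mem (hmem v hv)
  · exact Finset.mem_image_of_mem g (Finset.mem_univ _)
  · refine Finset.card_image_le.trans (le_of_eq ?_)
    simp [mul_comm]
  · have h1 := hF v hv i
    have h2 := hF (g (F v)) (Function.invFunOn_mem (hmem v hv)) i
    have h3 : F (g (F v)) = F v := Function.invFunOn_eq (hmem v hv)
    rw [h3] at h2
    have h4 := norm_sub_le_norm_sub_add_norm_sub (W.mulVec (fun j => ((v j : ℝ) : 𝕜)) i)
      (netCenter r W (F v) i) (W.mulVec (fun j => ((g (F v) j : ℝ) : 𝕜)) i)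
    rw [norm_sub_rev (netCenter r W (F v) i)] at h4
    linarith

/-- A union bound over a finite set of weights, for both signs of the parameter. -/
lemma IsSubgaussianGenerator.measureReal_exists_chaosExcess_ge_le {Ω : Type u}
    [MeasurableSpace Ω] {μ : Measure Ω} [IsProbabilityMeasure μ] {L : ℝ}
    {ξ : Fin n → Ω → ℝ} (h : IsSubgaussianGenerator μ L ξ) (hL : 1 ≤ L)
    {O : Matrix (Fin n) (Fin n) 𝕜} (hO : O ∈ Matrix.unitaryGroup (Fin n) 𝕜)
    (D : Finset (Fin n → ℝ)) (t s : ℝ) :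
    μ.real {ω | ∃ d ∈ D, s ≤ chaosExcess (squareRate L) O d (fun i => ξ i ω) t ∨
      s ≤ chaosExcess (squareRate L) O d (fun i => ξ i ω) (-t)} ≤
      D.card * (2 * Real.exp (-s)) := by
  have e : {ω | ∃ d ∈ D, s ≤ chaosExcess (squareRate L) O d (fun i => ξ i ω) t ∨
      s ≤ chaosExcess (squareRate L) O d (fun i => ξ i ω) (-t)} =
      ⋃ d ∈ D, ({ω | s ≤ chaosExcess (squareRate L) O d (fun i => ξ i ω) t} ∪
        {ω | s ≤ chaosExcess (squareRate L) O d (fun i => ξ i ω) (-t)}) := by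
    ext ω
    simp
  rw [e]
  refine (measureReal_biUnion_finset_le _ _).trans ?_
  rw [← nsmul_eq_mul]
  refine Finset.sum_le_card_nsmul _ _ _ fun d _ => ?_
  refine (measureReal_union_le _ _).trans ?_
  have h1 := h.measureReal_chaos_ge_le hL hO d t s
  have h2 := h.measureReal_chaos_ge_le hL hO d (-t) s
  unfold chaosExcess
  linarith

lemma IsSubgaussianGenerator.measureReal_diagonalForm_le {Ω : Type u}
    [MeasurableSpace Ω] {μ : Measure Ω} [IsProbabilityMeasure μ] {L : ℝ}
    {ξ : Fin n → Ω → ℝ} (h : IsSubgaussianGenerator μ L ξ) (hL : 1 ≤ L) (hn : 1 ≤ n)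
    (hβ : 0 < β) {O : Matrix (Fin n) (Fin n) 𝕜} (hO : IsHadamardType β O)
    {d : Fin n → ℝ} (hd : ∀ i, 0 ≤ d i) (hd1 : ∑ i, d i = 1) :
    μ.real {ω | diagonalForm O d (fun i => ξ i ω) ≤ 3 / 4} ≤
      Real.exp (-(squareRate L ^ 2 / (128 * β ^ 2) * n)) := by
  have ha := squareRate_pos hL
  set a := squareRate L with had
  have hn0 : (0 : ℝ) < n := by exact_mod_cast hn
  set t := n * a ^ 2 / (16 * β ^ 2) with ht
  have ht0 : 0 < t := by positivity
  have h1 := h.expMoment_neg_diagonalForm_le hL hO.1 hd hd1 (sum_mul_norm_sq_le hO hd hd1) ht0.le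
  have hm := h.measurable_comp (measurable_diagonalForm O d)
  have h2 := measureReal_le_of_expMoment_le (t := -(t * (3 / 4))) (hm.const_mul t).neg h1
  refine (measureReal_mono fun ω hω => ?_).trans (h2.trans (Real.exp_le_exp.2 (le_of_eq ?_)))
  · change diagonalForm O d _ ≤ 3 / 4 at hω
    change -(t * (3 / 4)) ≤ -(t * diagonalForm O d _)
    gcongr
  · rw [← had, ht]
    field_simp
    ring

end Chain

/-! ### The uniform lower bound -/

section Uniform

variable {𝕜 : Type w} [RCLike 𝕜] {n r : ℕ} {β : ℝ}

lemma sq_transformWeight_sub_le {W : Matrix (Fin n) (Fin n) 𝕜} {u v : EuclideanSpace ℝ (Fin n)}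
    {δ : ℝ} {i : Fin n} (h : ‖W.mulVec (fun j => ((u j : ℝ) : 𝕜)) i
      - W.mulVec (fun j => ((v j : ℝ) : 𝕜)) i‖ ≤ δ) :
    (transformWeight W u i - transformWeight W v i) ^ 2 ≤
      2 * δ ^ 2 * transformWeight W u i + 2 * δ ^ 2 * transformWeight W v i := by
  unfold transformWeight
  set x := W.mulVec (fun j => ((u j : ℝ) : 𝕜)) i
  set y := W.mulVec (fun j => ((v j : ℝ) : 𝕜)) i
  have h1 : (‖x‖ - ‖y‖) ^ 2 ≤ δ ^ 2 := by
    rw [← sq_abs (‖x‖ - ‖y‖)]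
    exact pow_le_pow_left₀ (abs_nonneg _) ((abs_norm_sub_norm_le x y).trans h) 2
  calc (‖x‖ ^ 2 - ‖y‖ ^ 2) ^ 2 = (‖x‖ - ‖y‖) ^ 2 * (‖x‖ + ‖y‖) ^ 2 := by ring
    _ ≤ δ ^ 2 * (2 * (‖x‖ ^ 2 + ‖y‖ ^ 2)) := by
        gcongr
        nlinarith [sq_nonneg (‖x‖ - ‖y‖)]
    _ = _ := by ring

lemma abs_weightedForm_sub_le {a : ℝ} (ha : 0 < a) {W O : Matrix (Fin n) (Fin n) 𝕜}
    {u : EuclideanSpace ℝ (Fin n)} {x : Fin n → ℝ} {b s M C : ℝ} (hb : 0 < b) (hs : 0 < s)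
    (hu : ∀ i, transformWeight W u i ≤ b ^ 2) (hM0 : 0 ≤ M) (hC0 : 0 ≤ C)
    (hM : weightedForm O (transformWeight W u) x ≤ M)
    (hC : diagonalForm O (transformWeight W u) x ≤ C)
    (h1 : chaosExcess a O (transformWeight W u) x (√s / b) < s)
    (h2 : chaosExcess a O (transformWeight W u) x (-(√s / b)) < s) :
    |weightedForm O (transformWeight W u) x - diagonalForm O (transformWeight W u) x| ≤
      √s * b * (1 + 32 / a * (2 * M + 3 * C)) := by
  have hsq : ∀ i, transformWeight W u i ^ 2 ≤
      b ^ 2 * transformWeight W u i + 0 * transformWeight W u i := by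
    intro i
    have := transformWeight_nonneg W u i
    nlinarith [hu i]
  have q1 := weightedForm_mono O hsq x
  have q2 := diagonalForm_mono O hsq x
  rw [weightedForm_linear] at q1
  rw [diagonalForm_linear] at q2
  have q3 : b ^ 2 * weightedForm O (transformWeight W u) x ≤ b ^ 2 * M := by gcongr
  have q4 : b ^ 2 * diagonalForm O (transformWeight W u) x ≤ b ^ 2 * C := by gcongr
  have q5 : 0 ≤ b ^ 2 * M := by positivity
  have q6 : 0 ≤ b ^ 2 * C := by positivity
  have key := abs_sub_le_of_chaosExcess_lt ha (δ := b) (Q := 4 * (2 * M + 3 * C)) hs hb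
    (by linarith) h1 h2
  exact key.trans (le_of_eq (by ring))

lemma abs_weightedForm_sub_sub_le {a : ℝ} (ha : 0 < a) {W O : Matrix (Fin n) (Fin n) 𝕜}
    {u u' : EuclideanSpace ℝ (Fin n)} {x : Fin n → ℝ} {δ s M C : ℝ} (hδ : 0 < δ) (hs : 0 < s)
    (hdist : ∀ i, ‖W.mulVec (fun j => ((u' j : ℝ) : 𝕜)) i
      - W.mulVec (fun j => ((u j : ℝ) : 𝕜)) i‖ ≤ δ)
    (hM : weightedForm O (transformWeight W u) x ≤ M)
    (hM' : weightedForm O (transformWeight W u') x ≤ M)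
    (hC : diagonalForm O (transformWeight W u) x ≤ C)
    (hC' : diagonalForm O (transformWeight W u') x ≤ C)
    (h1 : chaosExcess a O (fun i => transformWeight W u' i - transformWeight W u i) x
      (√s / δ) < s)
    (h2 : chaosExcess a O (fun i => transformWeight W u' i - transformWeight W u i) x
      (-(√s / δ)) < s) :
    |(weightedForm O (transformWeight W u') x - diagonalForm O (transformWeight W u') x)
      - (weightedForm O (transformWeight W u) x - diagonalForm O (transformWeight W u) x)| ≤
      √s * δ * (1 + 32 / a * (2 * M + 3 * C)) := by
  have hsq := fun i => sq_transformWeight_sub_le (hdist i)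
  have q1 := weightedForm_mono O hsq x
  have q2 := diagonalForm_mono O hsq x
  rw [weightedForm_linear] at q1
  rw [diagonalForm_linear] at q2
  have hδ2 : 0 ≤ 2 * δ ^ 2 := by positivity
  have r1 := mul_le_mul_of_nonneg_left hM hδ2
  have r2 := mul_le_mul_of_nonneg_left hM' hδ2
  have r3 := mul_le_mul_of_nonneg_left hC hδ2
  have r4 := mul_le_mul_of_nonneg_left hC' hδ2
  have key := abs_sub_le_of_chaosExcess_lt ha (δ := δ) (Q := 4 * (2 * M + 3 * C)) hs hδ
    (by linarith) h1 h2
  have e1 := weightedForm_linear O 1 (-1) (transformWeight W u') (transformWeight W u) x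
  have e2 := diagonalForm_linear O 1 (-1) (transformWeight W u') (transformWeight W u) x
  simp only [one_mul, neg_mul, ← sub_eq_add_neg] at e1 e2
  rw [e1, e2] at key
  have hre : ∀ p q p' q' : ℝ, p - q - (p' - q') = p - p' - (q - q') := fun _ _ _ _ => by ring
  rw [hre]
  exact key.trans (le_of_eq (by ring))

/-- The uniform lower bound. At the level `k` of the chain the points are approximated by
`(2 n) ^ (m₀ 2 ^ k)` points; the deviations are chosen so that every level is absorbed by the union
bound over its pairs with a surplus `A`, and the size `√s δ` of each increment is then of order
`√(r / n) log n`. -/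
lemma IsSubgaussianGenerator.measureReal_exists_weightedForm_lt_le {Ω : Type u}
    [MeasurableSpace Ω] {μ : Measure Ω} [IsProbabilityMeasure μ] {L : ℝ}
    {ξ : Fin n → Ω → ℝ} (h : IsSubgaussianGenerator μ L ξ) (hL : 1 ≤ L) (hβ : 0 < β)
    (hr : 1 ≤ r) (hn : 1 ≤ n) {W O : Matrix (Fin n) (Fin n) 𝕜}
    (hW : IsHadamardType β W) (hO : IsHadamardType β O)
    {V : Finset (EuclideanSpace ℝ (Fin n))} (hV : ↑V ⊆ sparseSphere n r) {m₀ K : ℕ} {A : ℝ}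
    (hm₀ : 1 ≤ m₀) (hA1 : m₀ * Real.log (2 * n) ≤ A) (hA2 : A ≤ 2 * (m₀ * Real.log (2 * n)))
    (hAn : A ≤ n) (hcard : V.card ≤ (2 * n) ^ (m₀ * 2 ^ K))
    (hcard' : V.card * Real.exp (-(squareRate L ^ 2 / (128 * β ^ 2) * n)) ≤ Real.exp (-A))
    (hsmall : (β * √((r : ℝ) / n) * √(2 * A)
        + K * (72 * (β * √((r : ℝ) / n)) * Real.log (4 * n))) *
      (8 * (1 + 128 / squareRate L
        + 224 * (2 * β ^ 2 / squareRate L) / squareRate L)) ≤ 1) :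
    μ.real {ω | ∃ v ∈ V, weightedForm O (transformWeight W v) (fun i => ξ i ω) < 5 / 8} ≤
      6 * Real.exp (-A) := by
  classical
  have ha := squareRate_pos hL
  set a := squareRate L with had
  have hn0 : (0 : ℝ) < n := by exact_mod_cast hn
  have hn1 : (1 : ℝ) ≤ n := by exact_mod_cast hn
  have hr0 : (0 : ℝ) < r := by exact_mod_cast hr
  have hm00 : (1 : ℝ) ≤ m₀ := by exact_mod_cast hm₀
  set b := β * √((r : ℝ) / n) with hb
  have hb0 : 0 < b := by positivity
  set l := Real.log (2 * n) with hl
  have hl2 : Real.log 2 ≤ l := Real.log_le_log (by norm_num) (by linarith)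
  have hl0 : 0 < l := (Real.log_pos (by norm_num)).trans_le hl2
  set l4 := Real.log (4 * n) with hl4
  have hll4 : l ≤ l4 := Real.log_le_log (by positivity) (by linarith)
  have hl40 : 0 < l4 := hl0.trans_le hll4
  have hA0 : 0 < A := by
    refine lt_of_lt_of_le ?_ hA1
    positivity
  set e : ℕ → ℝ := fun k => 12 * b * √(l4 / (m₀ * 2 ^ k : ℕ)) with he
  have he0 : ∀ k, 0 < e k := fun k => by
    have : (0 : ℝ) < (m₀ * 2 ^ k : ℕ) := by positivity
    simp only [he]
    positivity
  have hestep : ∀ k, e (k + 1) ≤ e k := fun k => by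
    simp only [he]
    have : (0 : ℝ) < (m₀ * 2 ^ k : ℕ) := by positivity
    gcongr
    · norm_num
    · omega
  have hP : ∀ k, ∃ P : EuclideanSpace ℝ (Fin n) → EuclideanSpace ℝ (Fin n), (∀ v ∈ V, P v ∈ V) ∧
      (∃ T : Finset (EuclideanSpace ℝ (Fin n)), (∀ v ∈ V, P v ∈ T) ∧
        T.card ≤ (2 * n) ^ (m₀ * 2 ^ k)) ∧
      (∀ v ∈ V, ∀ i, ‖W.mulVec (fun j => ((v j : ℝ) : 𝕜)) i
          - W.mulVec (fun j => ((P v j : ℝ) : 𝕜)) i‖ ≤ e k) ∧ (k = K → ∀ v ∈ V, P v = v) := by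
    intro k
    by_cases hk : k = K
    · subst hk
      exact ⟨id, fun v hv => hv, ⟨V, fun v hv => hv, hcard⟩,
        fun v _ i => by simpa using (he0 k).le, fun _ v _ => rfl⟩
    · obtain ⟨P, h1, h2, h3⟩ := exists_projection hβ hr hn hW hV
        (m := m₀ * 2 ^ k) (by positivity)
      exact ⟨P, h1, h2, h3, fun hk' => absurd hk' hk⟩
  choose P hPV hT hPe hPK using hP
  choose T hPT hTc using hT
  have hTc' : ∀ k, ((T k).card : ℝ) ≤ Real.exp (m₀ * 2 ^ k * l) := by
    intro k
    have h1 : ((T k).card : ℝ) ≤ (2 * n) ^ (m₀ * 2 ^ k) := by exact_mod_cast hTc k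
    refine h1.trans (le_of_eq ?_)
    have h2 : Real.exp ((m₀ * 2 ^ k : ℕ) * l) = (2 * n) ^ (m₀ * 2 ^ k) := by
      rw [Real.exp_nat_mul, hl, Real.exp_log (by positivity)]
    rw [← h2]
    push_cast
    rfl
  -- exceptional events: large `∑ ξᵢ²`, a small diagonal part, a large excess at the coarsest net or
  -- along some link of the chain; `s k` beats the cardinality of the `k`-th set of links
  let s₀ : ℝ := A + m₀ * l
  let s : ℕ → ℝ := fun k => A + 5 * (m₀ * 2 ^ k * l)
  let D₀ : Finset (Fin n → ℝ) := (T 0).image (transformWeight W)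
  let D : ℕ → Finset (Fin n → ℝ) := fun k =>
    Finset.image₂ (fun u u' i => transformWeight W u' i - transformWeight W u i) (T k) (T (k + 1))
  let bad : Finset (Fin n → ℝ) → ℝ → ℝ → Set Ω := fun D t s =>
    {ω | ∃ d ∈ D, s ≤ chaosExcess a O d (fun i => ξ i ω) t ∨
      s ≤ chaosExcess a O d (fun i => ξ i ω) (-t)}
  let B₁ : Set Ω := {ω | 2 * (n : ℝ) ≤ ∑ i, a * ξ i ω ^ 2}
  let B₂ : Set Ω := ⋃ v ∈ V, {ω | diagonalForm O (transformWeight W v) (fun i => ξ i ω) ≤ 3 / 4}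
  let B₃ : Set Ω := bad D₀ (√s₀ / b) s₀
  let B₄ : Set Ω := ⋃ k ∈ Finset.range K, bad (D k) (√(s k) / (2 * e k)) (s k)
  have hB₁ : μ.real B₁ ≤ Real.exp (-A) :=
    (h.measureReal_sum_sq_ge_le hL).trans (Real.exp_le_exp.2 (by linarith))
  have hB₂ : μ.real B₂ ≤ Real.exp (-A) := by
    refine (measureReal_biUnion_finset_le _ _).trans (le_trans ?_ hcard')
    rw [← nsmul_eq_mul]
    exact Finset.sum_le_card_nsmul _ _ _ fun v hv => h.measureReal_diagonalForm_le hL hn hβ hO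
      (transformWeight_nonneg W v) (sum_transformWeight hW.1 (hV hv))
  have hB₃ : μ.real B₃ ≤ 2 * Real.exp (-A) := by
    refine (h.measureReal_exists_chaosExcess_ge_le hL hO.1 D₀ _ s₀).trans ?_
    have h1 : (D₀.card : ℝ) ≤ Real.exp (m₀ * l) := by
      have h2 : (D₀.card : ℝ) ≤ (T 0).card := by exact_mod_cast Finset.card_image_le
      simpa using h2.trans (hTc' 0)
    calc (D₀.card : ℝ) * (2 * Real.exp (-s₀)) ≤ Real.exp (m₀ * l) * (2 * Real.exp (-s₀)) := by
          gcongr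
      _ = 2 * Real.exp (-A) := by
          rw [mul_left_comm, ← Real.exp_add]; congr 2; simp only [s₀]; ring
  have hB₄ : μ.real B₄ ≤ 2 * Real.exp (-A) := by
    have h1 : ∀ k, μ.real (bad (D k) (√(s k) / (2 * e k)) (s k)) ≤
        2 * Real.exp (-A) * ((1 / 2) ^ k * (1 / 2)) := by
      intro k
      refine (h.measureReal_exists_chaosExcess_ge_le hL hO.1 (D k) _ (s k)).trans ?_
      have h2 : ((D k).card : ℝ) ≤ Real.exp (m₀ * 2 ^ k * l) * Real.exp (m₀ * 2 ^ (k + 1) * l) := by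
        have h3 : ((D k).card : ℝ) ≤ (T k).card * (T (k + 1)).card := by
          exact_mod_cast Finset.card_image₂_le _ _ _
        exact h3.trans (mul_le_mul (hTc' k) (hTc' (k + 1)) (by positivity) (Real.exp_pos _).le)
      calc ((D k).card : ℝ) * (2 * Real.exp (-s k))
          ≤ (Real.exp (m₀ * 2 ^ k * l) * Real.exp (m₀ * 2 ^ (k + 1) * l)) *
              (2 * Real.exp (-s k)) := by gcongr
        _ = 2 * Real.exp (-A + -(2 * (m₀ * 2 ^ k * l))) := by
            rw [← Real.exp_add, mul_left_comm, ← Real.exp_add]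
            congr 2
            simp only [s]
            ring
        _ ≤ 2 * Real.exp (-A + -((k + 1 : ℕ) * Real.log 2)) := by
            refine mul_le_mul_of_nonneg_left (Real.exp_le_exp.2 ?_) (by norm_num)
            have h3 : ((k + 1 : ℕ) : ℝ) ≤ 2 ^ k := by exact_mod_cast Nat.lt_two_pow_self
            have h4 : 1 * 2 ^ k * Real.log 2 ≤ m₀ * 2 ^ k * l := by gcongr
            have h5 : ((k + 1 : ℕ) : ℝ) * Real.log 2 ≤ 2 ^ k * Real.log 2 := by
              have := Real.log_pos (by norm_num : (1 : ℝ) < 2)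
              gcongr
            have h6 : 0 ≤ (m₀ : ℝ) * 2 ^ k * l := by positivity
            linarith
        _ = 2 * Real.exp (-A) * ((1 / 2) ^ k * (1 / 2)) := by
            rw [Real.exp_add, ← mul_neg, ← Real.log_inv, Real.exp_nat_mul,
              Real.exp_log (by norm_num), pow_succ]
            norm_num
            ring
    refine (measureReal_biUnion_finset_le _ _).trans ((Finset.sum_le_sum fun k _ => h1 k).trans ?_)
    rw [← Finset.mul_sum, ← Finset.sum_mul]
    have h2 := sum_geometric_two_le K
    have h3 : 0 < 2 * Real.exp (-A) := by positivity
    nlinarith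
  have hsub : {ω | ∃ v ∈ V, weightedForm O (transformWeight W v) (fun i => ξ i ω) < 5 / 8} ⊆
      B₁ ∪ B₂ ∪ B₃ ∪ B₄ := by
    intro ω hω
    by_contra hc
    simp only [Set.mem_union, not_or] at hc
    obtain ⟨⟨⟨hc₁, hc₂⟩, hc₃⟩, hc₄⟩ := hc
    obtain ⟨v, hv, hlt⟩ := hω
    refine absurd hlt (not_lt.2 ?_)
    set x : Fin n → ℝ := fun i => ξ i ω with hx
    have hZC : ∀ v ∈ V, diagonalForm O (transformWeight W v) x ≤ 2 * β ^ 2 / a := by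
      intro v hv
      have h1 : ∑ i, a * ξ i ω ^ 2 < 2 * n := not_le.1 hc₁
      rw [← Finset.mul_sum] at h1
      calc diagonalForm O (transformWeight W v) x ≤ ∑ k, β ^ 2 / n * x k ^ 2 := by
            unfold diagonalForm
            exact Finset.sum_le_sum fun k _ => mul_le_mul_of_nonneg_right
              (sum_mul_norm_sq_le hO (transformWeight_nonneg W v)
                (sum_transformWeight hW.1 (hV hv)) k) (sq_nonneg _)
        _ = β ^ 2 / (n * a) * (a * ∑ k, ξ k ω ^ 2) := by
            rw [← Finset.mul_sum]; field_simp; rfl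
        _ ≤ β ^ 2 / (n * a) * (2 * n) := by gcongr
        _ = _ := by field_simp
    have hZl : ∀ v ∈ V, 3 / 4 ≤ diagonalForm O (transformWeight W v) x := by
      intro v hv
      by_contra hlt
      exact hc₂ (Set.mem_iUnion₂.2 ⟨v, hv, (not_le.1 hlt).le⟩)
    have hM0 : ∀ M, (∀ v ∈ V, weightedForm O (transformWeight W v) x ≤ M) → 0 ≤ M := fun M hM =>
      (weightedForm_nonneg O (transformWeight_nonneg W v) x).trans (hM v hv)
    have hC0 : 0 ≤ 2 * β ^ 2 / a := by positivity
    refine le_of_chain (X := fun v => weightedForm O (transformWeight W v) x)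
      (Z := fun v => diagonalForm O (transformWeight W v) x) (P := P) (K := K) ha hC0
      (fun v hv => hPK K rfl v hv) (ε₀ := b * √(2 * A)) (ε := 72 * b * l4) (by positivity)
      (by positivity) hZl hZC ?_ ?_ hsmall hv
    · intro M hM v hv
      have hM' := hM0 M hM
      have hu := hPV 0 v hv
      set u := P 0 v
      have hnot : ∀ d ∈ D₀, chaosExcess a O d x (√s₀ / b) < s₀ ∧
          chaosExcess a O d x (-(√s₀ / b)) < s₀ := by
        intro d hd
        by_contra hcon
        refine hc₃ ⟨d, hd, ?_⟩
        by_contra hcon'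
        push Not at hcon'
        exact hcon hcon'
      obtain ⟨g1, g2⟩ := hnot _ (Finset.mem_image_of_mem _ (hPT 0 v hv))
      have hub : ∀ i, transformWeight W u i ≤ b ^ 2 := by
        intro i
        have h2 : b ^ 2 = β ^ 2 * r / n := by
          rw [hb, mul_pow, Real.sq_sqrt (by positivity)]; ring
        rw [h2]
        exact transformWeight_le hβ.le hW (hV hu) i
      have key := abs_weightedForm_sub_le ha hb0 (by positivity : 0 < s₀) hub hM' hC0 (hM u hu)
        (hZC u hu) g1 g2
      refine key.trans ?_
      have hs : √s₀ * b ≤ b * √(2 * A) := by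
        rw [mul_comm]
        have : s₀ ≤ 2 * A := by simp only [s₀]; linarith
        gcongr
      gcongr
    · intro M hM k hk v hv
      have hM' := hM0 M hM
      have hu := hPV k v hv
      have hu' := hPV (k + 1) v hv
      have hnot : ∀ d ∈ D k, chaosExcess a O d x (√(s k) / (2 * e k)) < s k ∧
          chaosExcess a O d x (-(√(s k) / (2 * e k))) < s k := by
        intro d hd
        by_contra hcon
        refine hc₄ (Set.mem_iUnion₂.2 ⟨k, Finset.mem_range.2 hk, d, hd, ?_⟩)
        by_contra hcon'
        push Not at hcon'
        exact hcon hcon'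
      obtain ⟨g1, g2⟩ := hnot _ (Finset.mem_image₂_of_mem (hPT k v hv) (hPT (k + 1) v hv))
      have hdist : ∀ i, ‖W.mulVec (fun j => ((P (k + 1) v j : ℝ) : 𝕜)) i
          - W.mulVec (fun j => ((P k v j : ℝ) : 𝕜)) i‖ ≤ 2 * e k := by
        intro i
        have h1 := hPe k v hv i
        have h2 := hPe (k + 1) v hv i
        have h3 := norm_sub_le_norm_sub_add_norm_sub
          (W.mulVec (fun j => ((P (k + 1) v j : ℝ) : 𝕜)) i)
          (W.mulVec (fun j => ((v j : ℝ) : 𝕜)) i) (W.mulVec (fun j => ((P k v j : ℝ) : 𝕜)) i)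
        rw [norm_sub_rev (W.mulVec (fun j => ((P (k + 1) v j : ℝ) : 𝕜)) i)
          (W.mulVec (fun j => ((v j : ℝ) : 𝕜)) i)] at h3
        linarith [hestep k]
      have hs0 : 0 < s k := by positivity
      have key := abs_weightedForm_sub_sub_le ha (by linarith [he0 k] : 0 < 2 * e k) hs0 hdist
        (hM _ hu) (hM _ hu') (hZC _ hu) (hZC _ hu') g1 g2
      refine key.trans ?_
      have hsz : √(s k) * (2 * e k) ≤ 72 * b * l4 := by
        have hmk : (0 : ℝ) < m₀ * 2 ^ k := by positivity
        have h2k : (1 : ℝ) ≤ 2 ^ k := one_le_pow₀ (by norm_num)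
        have h1 : s k ≤ 7 * (m₀ * 2 ^ k) * l4 := by
          have h2 : m₀ * 1 * l ≤ m₀ * 2 ^ k * l := by gcongr
          have h3 : (m₀ : ℝ) * 2 ^ k * l ≤ m₀ * 2 ^ k * l4 := by gcongr
          simp only [s]
          linarith
        have h4 : √(s k) * √(l4 / (m₀ * 2 ^ k)) ≤ 3 * l4 := by
          rw [← Real.sqrt_mul hs0.le]
          apply Real.sqrt_le_iff.2 ⟨by positivity, _⟩
          calc s k * (l4 / (m₀ * 2 ^ k)) ≤ 7 * (m₀ * 2 ^ k) * l4 * (l4 / (m₀ * 2 ^ k)) := by gcongr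
            _ = 7 * l4 ^ 2 := by field_simp
            _ ≤ (3 * l4) ^ 2 := by nlinarith [sq_nonneg l4]
        simp only [he]
        push_cast
        calc √(s k) * (2 * (12 * b * √(l4 / (m₀ * 2 ^ k))))
            = 24 * b * (√(s k) * √(l4 / (m₀ * 2 ^ k))) := by ring
          _ ≤ 24 * b * (3 * l4) := by gcongr
          _ = _ := by ring
      gcongr
  refine (measureReal_mono hsub).trans ?_
  have u1 := measureReal_union_le (μ := μ) (B₁ ∪ B₂ ∪ B₃) B₄
  have u2 := measureReal_union_le (μ := μ) (B₁ ∪ B₂) B₃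
  have u3 := measureReal_union_le (μ := μ) B₁ B₂
  linarith

end Uniform

/-! ### Constants and cardinalities -/

section Assembly

lemma two_pow_sOne_mul_log_le {n r : ℕ} (hr : 1 ≤ r) (hrn : r ≤ n) :
    (2 : ℝ) ^ sOne n r * Real.log 2 ≤ 40 * r * Real.log (2 * n) := by
  have hr0 : (0 : ℝ) < r := by exact_mod_cast hr
  have hr1 : (1 : ℝ) ≤ r := by exact_mod_cast hr
  have hrn' : (r : ℝ) ≤ n := by exact_mod_cast hrn
  have hn0 : (0 : ℝ) < n := hr0.trans_le hrn'
  have hl2 := Real.log_pos (by norm_num : (1 : ℝ) < 2)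
  have hl2' : Real.log 2 < 1 := by linarith [Real.log_two_lt_d9]
  have hlog : Real.log (Real.exp 1 * n / r) = 1 + Real.log n - Real.log r := by
    rw [Real.log_div (by positivity) (by positivity), Real.log_mul (by positivity) (by positivity),
      Real.log_exp]
  have hlogr : Real.log (Real.exp 1 * r) = 1 + Real.log r := by
    rw [Real.log_mul (by positivity) (by positivity), Real.log_exp]
  have h1 : Real.log r ≤ Real.log n := Real.log_le_log hr0 hrn'
  have h0 : 0 ≤ Real.log r := Real.log_nonneg hr1
  have hpos : 0 < 1 + Real.log n - Real.log r := by linarith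
  set x := rho n r * r * Real.log (Real.exp 1 * n / r) with hx
  -- the factor `max 1 (log (e r) / log (e n / r))` of `ρ` absorbs the logarithm
  have hxe : x = 10 / Real.log 2 * r *
      (max 1 ((1 + Real.log r) / (1 + Real.log n - Real.log r))
        * (1 + Real.log n - Real.log r)) := by
    rw [hx, rho, hlog, hlogr, Real.logb, Real.log_exp]
    ring
  have hmax : max 1 ((1 + Real.log r) / (1 + Real.log n - Real.log r))
      * (1 + Real.log n - Real.log r) ≤ 1 + Real.log n := by
    rw [max_mul_of_nonneg _ _ hpos.le, one_mul, div_mul_cancel₀ _ hpos.ne']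
    exact max_le (by linarith) (by linarith)
  have hmax' : 1 ≤ max 1 ((1 + Real.log r) / (1 + Real.log n - Real.log r))
      * (1 + Real.log n - Real.log r) := by
    rw [max_mul_of_nonneg _ _ hpos.le, one_mul]
    exact le_max_of_le_left (by linarith)
  have hx1 : 1 ≤ x := by
    rw [hxe]
    have : 1 ≤ 10 / Real.log 2 := by rw [le_div_iff₀ hl2]; linarith
    nlinarith [mul_le_mul this hr1 (by norm_num) (by positivity)]
  have hxu : x * Real.log 2 ≤ 10 * r * (1 + Real.log n) := by
    rw [hxe]
    calc _ = 10 * r * (max 1 ((1 + Real.log r) / (1 + Real.log n - Real.log r))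
          * (1 + Real.log n - Real.log r)) := by field_simp
      _ ≤ _ := by gcongr
  have hs : (2 : ℝ) ^ sOne n r ≤ 2 * x := by
    have h2 : (sOne n r : ℝ) ≤ Real.logb 2 x + 1 :=
      (Nat.ceil_lt_add_one (Real.logb_nonneg (by norm_num) hx1)).le
    calc (2 : ℝ) ^ sOne n r = (2 : ℝ) ^ (sOne n r : ℝ) := (Real.rpow_natCast 2 _).symm
      _ ≤ (2 : ℝ) ^ (Real.logb 2 x + 1) := Real.rpow_le_rpow_of_exponent_le (by norm_num) h2
      _ = 2 * x := by
        rw [Real.rpow_add (by norm_num), Real.rpow_logb (by norm_num) (by norm_num) (by linarith),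
          Real.rpow_one, mul_comm]
  have hfin : 1 + Real.log n ≤ 2 * Real.log (2 * n) := by
    rw [Real.log_mul (by norm_num) hn0.ne']
    linarith [Real.log_two_gt_d9]
  calc (2 : ℝ) ^ sOne n r * Real.log 2 ≤ 2 * x * Real.log 2 := by gcongr
    _ ≤ 2 * (10 * r * (1 + Real.log n)) := by linarith
    _ ≤ 2 * (10 * r * (2 * Real.log (2 * n))) := by gcongr
    _ = _ := by ring

lemma card_le_of_isAdmissibleLevel {n r : ℕ} (hr : 1 ≤ r) (hrn : r ≤ n)
    {V : Finset (EuclideanSpace ℝ (Fin n))}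
    (hV : IsAdmissibleLevel (sparseSphere n r) (sOne n r) V) :
    (V.card : ℝ) ≤ Real.exp (40 * r * Real.log (2 * n)) := by
  have h1 : (V.card : ℝ) ≤ 2 ^ (2 ^ sOne n r) := by exact_mod_cast hV.2
  refine h1.trans ?_
  rw [← Real.log_le_iff_le_exp (by positivity), Real.log_pow]
  push_cast
  exact two_pow_sOne_mul_log_le hr hrn

/-- The number of levels of the chain is of order `log n`. -/
lemma clog_mul_log_le {n : ℕ} (hn : 3 ≤ n) :
    (Nat.clog 2 (40 * n) : ℝ) * Real.log (4 * n) ≤ 27 * Real.log n ^ 2 := by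
  have hn3 : (3 : ℝ) ≤ n := by exact_mod_cast hn
  have hn0 : (0 : ℝ) < n := by linarith
  have hl1 : 1 ≤ Real.log n := by
    rw [Real.le_log_iff_exp_le hn0]
    linarith [Real.exp_one_lt_d9]
  have hl2 := Real.log_two_gt_d9
  have h4 : Real.log (4 * n) ≤ 3 * Real.log n := by
    have : Real.log 4 = 2 * Real.log 2 := by
      rw [show (4 : ℝ) = 2 ^ 2 by norm_num, Real.log_pow]; norm_num
    rw [Real.log_mul (by norm_num) hn0.ne', this]
    linarith [Real.log_two_lt_d9]
  have h40 : Real.log (40 * n) ≤ 5 * Real.log n := by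
    have : Real.log 40 ≤ 4 := by
      rw [Real.log_le_iff_le_exp (by norm_num)]
      calc (40 : ℝ) ≤ 2.7 ^ 4 := by norm_num
        _ ≤ Real.exp 1 ^ 4 := by gcongr; linarith [Real.exp_one_gt_d9]
        _ = Real.exp 4 := by rw [← Real.exp_nat_mul]; norm_num
    rw [Real.log_mul (by norm_num) hn0.ne']
    linarith
  have hK : (Nat.clog 2 (40 * n) : ℝ) ≤ 9 * Real.log n := by
    have h1 : 2 ^ (Nat.clog 2 (40 * n) - 1) < 40 * n :=
      Nat.pow_pred_clog_lt_self (by norm_num) (by omega)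
    have h2 : (2 : ℝ) ^ (Nat.clog 2 (40 * n) - 1) ≤ 40 * n := by exact_mod_cast h1.le
    have h3 := Real.log_le_log (by positivity) h2
    rw [Real.log_pow] at h3
    have hpos : 1 ≤ Nat.clog 2 (40 * n) := Nat.clog_pos (by norm_num) (by omega)
    have hpos' : (1 : ℝ) ≤ Nat.clog 2 (40 * n) := by exact_mod_cast hpos
    rw [Nat.cast_sub hpos, Nat.cast_one] at h3
    have h5 : ((Nat.clog 2 (40 * n) : ℝ) - 1) * 0.69 ≤
        ((Nat.clog 2 (40 * n) : ℝ) - 1) * Real.log 2 :=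
      mul_le_mul_of_nonneg_left (by linarith) (by linarith)
    linarith
  calc _ ≤ 9 * Real.log n * (3 * Real.log n) :=
        mul_le_mul hK h4 (Real.log_nonneg (by linarith)) (by linarith)
    _ = _ := by ring

/-- Since `𝔼 ‖Γ_v ξ‖² = n`, a constant of the small ball estimate cannot exceed `√(5 / 2)`, once the
right-hand side of the estimate is at most `1 / 2`. -/
lemma IsSmallBallPair.sq_le {𝕜 : Type w} [RCLike 𝕜] {L β κ₁ κ₂ : ℝ} (hL : 1 ≤ L)
    (hκ : IsSmallBallPair.{u, w} 𝕜 L β κ₁ κ₂) {n r : ℕ} (hr : 1 ≤ r) (hrn : r ≤ n)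
    (hlarge : 1 ≤ κ₂ * n / r) {U W O : Matrix (Fin n) (Fin n) 𝕜}
    (hU : IsHadamardType β U) (hW : IsHadamardType β W) (hO : IsHadamardType β O)
    {Ω : Type u} [MeasurableSpace Ω] {μ : Measure Ω} [IsProbabilityMeasure μ]
    {ξ : Fin n → Ω → ℝ} (h : IsSubgaussianGenerator μ L ξ) {v : EuclideanSpace ℝ (Fin n)}
    (hv : v ∈ sparseSphere n r) : κ₁ ^ 2 ≤ 5 / 2 := by
  by_contra! hc
  have hκ1 := hκ.1
  have hn0 : (0 : ℝ) < n := by exact_mod_cast (by omega : 0 < n)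
  have h1 := hκ.2.2 n r hr hrn U W O hU hW hO Ω μ ξ h v hv
  have h2 := h.measureReal_weightedForm_ge_le hL hO.1 (transformWeight_nonneg W v)
    (sum_transformWeight hW.1 hv) (by norm_num : (0 : ℝ) < 5 / 2)
  have h3 : (1 / 2 : ℝ) ^ (κ₂ * n / r) ≤ 1 / 2 := by
    calc (1 / 2 : ℝ) ^ (κ₂ * n / r) ≤ (1 / 2 : ℝ) ^ (1 : ℝ) :=
          Real.rpow_le_rpow_of_exponent_ge (by norm_num) (by norm_num) hlarge
      _ = 1 / 2 := Real.rpow_one _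
  have hcover : (Set.univ : Set Ω) ⊆
      {ω | normMulVec (gammaMatrix U W O v) (fun i => ξ i ω) ≤ κ₁ * √(n : ℝ) * ‖v‖} ∪
      {ω | 5 / 2 ≤ weightedForm O (transformWeight W v) (fun i => ξ i ω)} := by
    intro ω _
    by_cases hω : 5 / 2 ≤ weightedForm O (transformWeight W v) (fun i => ξ i ω)
    · exact Or.inr hω
    · left
      change normMulVec _ _ ≤ _
      rw [normMulVec_gammaMatrix hU.1, hv.1, mul_one, mul_comm κ₁]
      gcongr
      rw [Real.sqrt_le_left hκ1.le]
      linarith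
  have h4 := measureReal_mono (μ := μ) hcover
  rw [probReal_univ] at h4
  have h5 := h4.trans (measureReal_union_le _ _)
  linarith

/-- The total size of the increments along the chain. -/
lemma chain_size_mul_le_one {n r : ℕ} (hr : 1 ≤ r) (hn : 3 ≤ n) {β D c c₁ A : ℝ} (hβ : 0 < β)
    (hD : 0 < D) (hcD : c ≤ 1 / (8 * β ^ 2 * D ^ 2))
    (hc₁ : c₁ ≤ (1 / (4000 * β * D)) ^ 2) (hnr : (r : ℝ) * Real.log n ^ 4 ≤ c₁ * n)
    (hA : A = c * n / r) :
    (β * √((r : ℝ) / n) * √(2 * A)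
        + Nat.clog 2 (40 * n) * (72 * (β * √((r : ℝ) / n)) * Real.log (4 * n))) * D ≤ 1 := by
  have hr0 : (0 : ℝ) < r := by exact_mod_cast hr
  have hn0 : (0 : ℝ) < n := by exact_mod_cast (by omega : 0 < n)
  have e1 : β * √((r : ℝ) / n) * √(2 * A) ≤ 1 / (2 * D) := by
    rw [mul_assoc, ← Real.sqrt_mul (by positivity)]
    have : (r : ℝ) / n * (2 * A) = 2 * c := by rw [hA]; field_simp
    rw [this]
    have h2 : √(2 * c) ≤ 1 / (2 * β * D) := by
      apply Real.sqrt_le_iff.2 ⟨by positivity, _⟩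
      calc 2 * c ≤ 2 * (1 / (8 * β ^ 2 * D ^ 2)) := by gcongr
        _ = (1 / (2 * β * D)) ^ 2 := by field_simp; norm_num
    calc β * √(2 * c) ≤ β * (1 / (2 * β * D)) := by gcongr
      _ = 1 / (2 * D) := by field_simp
  have e2 : Nat.clog 2 (40 * n) * (72 * (β * √((r : ℝ) / n)) * Real.log (4 * n))
      ≤ 1 / (2 * D) := by
    have h1 := clog_mul_log_le hn
    have h2 : √((r : ℝ) / n) * Real.log n ^ 2 ≤ 1 / (4000 * β * D) := by
      have h3 : √((r : ℝ) / n) * Real.log n ^ 2 = √((r : ℝ) * Real.log n ^ 4 / n) := by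
        rw [mul_div_right_comm, Real.sqrt_mul (by positivity),
          show Real.log n ^ 4 = (Real.log n ^ 2) ^ 2 by ring, Real.sqrt_sq (by positivity)]
      rw [h3]
      apply Real.sqrt_le_iff.2 ⟨by positivity, _⟩
      refine le_trans ?_ hc₁
      rwa [div_le_iff₀ hn0]
    calc Nat.clog 2 (40 * n) * (72 * (β * √((r : ℝ) / n)) * Real.log (4 * n))
        = 72 * (β * √((r : ℝ) / n)) * (Nat.clog 2 (40 * n) * Real.log (4 * n)) := by ring
      _ ≤ 72 * (β * √((r : ℝ) / n)) * (27 * Real.log n ^ 2) := by gcongr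
      _ = 1944 * β * (√((r : ℝ) / n) * Real.log n ^ 2) := by ring
      _ ≤ 2000 * β * (1 / (4000 * β * D)) := by gcongr; norm_num
      _ = 1 / (2 * D) := by field_simp; norm_num
  calc _ ≤ (1 / (2 * D) + 1 / (2 * D)) * D := by gcongr
    _ = 1 := by field_simp; norm_num

/-- For `r log⁴ n` at most a small multiple of `n`, all the forms of an admissible level are at least
`5 / 8`, up to a probability exponentially small in `n / r`. -/
lemma exists_measureReal_exists_weightedForm_lt_le (𝕜 : Type w) [RCLike 𝕜] {L β : ℝ} (hL : 1 ≤ L)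
    (hβ : 1 ≤ β) :
    ∃ c c₁ : ℝ, 0 < c ∧ 0 < c₁ ∧
      ∀ (n r : ℕ), 1 ≤ r → r ≤ n → 3 ≤ n → (r : ℝ) * Real.log n ^ 4 ≤ c₁ * n →
      ∀ (W O : Matrix (Fin n) (Fin n) 𝕜), IsHadamardType β W → IsHadamardType β O →
      ∀ (Ω : Type u) [MeasurableSpace Ω] (μ : Measure Ω) [IsProbabilityMeasure μ]
        (ξ : Fin n → Ω → ℝ), IsSubgaussianGenerator μ L ξ →
      ∀ V : Finset (EuclideanSpace ℝ (Fin n)),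
        IsAdmissibleLevel (sparseSphere n r) (sOne n r) V →
        μ.real {ω | ∃ v ∈ V, weightedForm O (transformWeight W v) (fun i => ξ i ω) < 5 / 8} ≤
          6 * Real.exp (-(c * n / r)) := by
  have ha := squareRate_pos hL
  set a := squareRate L with had
  have hβ0 : 0 < β := by linarith
  set D := 8 * (1 + 128 / a + 224 * (2 * β ^ 2 / a) / a) with hD
  have hD0 : 0 < D := by positivity
  set c' := a ^ 2 / (128 * β ^ 2) with hc'
  have hc'0 : 0 < c' := by positivity
  set c := min 1 (min (c' / 2) (1 / (8 * β ^ 2 * D ^ 2))) with hc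
  have hc0 : 0 < c := lt_min one_pos (lt_min (by positivity) (by positivity))
  have hcA : c ≤ 1 := min_le_left _ _
  have hcB : c ≤ c' / 2 := (min_le_right _ _).trans (min_le_left _ _)
  have hcC : c ≤ 1 / (8 * β ^ 2 * D ^ 2) := (min_le_right _ _).trans (min_le_right _ _)
  set c₁ := min (c / 2) (min (c' / 160) ((1 / (4000 * β * D)) ^ 2)) with hc₁
  have hc₁0 : 0 < c₁ := lt_min (by positivity) (lt_min (by positivity) (by positivity))
  have hc₁A : c₁ ≤ c / 2 := min_le_left _ _
  have hc₁B : c₁ ≤ c' / 160 := (min_le_right _ _).trans (min_le_left _ _)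
  have hc₁C : c₁ ≤ (1 / (4000 * β * D)) ^ 2 := (min_le_right _ _).trans (min_le_right _ _)
  refine ⟨c, c₁, hc0, hc₁0, ?_⟩
  intro n r hr hrn hn3 hnr W O hW hO Ω _ μ _ ξ h V hV
  have hr0 : (0 : ℝ) < r := by exact_mod_cast hr
  have hr1 : (1 : ℝ) ≤ r := by exact_mod_cast hr
  have hrn' : (r : ℝ) ≤ n := by exact_mod_cast hrn
  have hn3' : (3 : ℝ) ≤ n := by exact_mod_cast hn3
  have hn0 : (0 : ℝ) < n := by linarith
  set ℓ := Real.log n with hℓ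
  have hℓ1 : 1 ≤ ℓ := by
    rw [hℓ, Real.le_log_iff_exp_le hn0]
    linarith [Real.exp_one_lt_d9]
  have hℓ4 : ℓ ≤ ℓ ^ 4 := by
    calc ℓ = ℓ ^ 1 := (pow_one _).symm
      _ ≤ ℓ ^ 4 := pow_le_pow_right₀ hℓ1 (by norm_num)
  set l := Real.log (2 * n) with hl
  have hl0 : 0 < l := Real.log_pos (by linarith)
  have hlℓ : l ≤ 2 * ℓ := by
    rw [hl, Real.log_mul (by norm_num) hn0.ne']
    have : Real.log 2 ≤ ℓ := Real.log_le_log (by norm_num) (by linarith)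
    linarith
  have hrl : r * l ≤ 2 * c₁ * n := by
    calc r * l ≤ r * (2 * ℓ ^ 4) := mul_le_mul_of_nonneg_left (by linarith) hr0.le
      _ ≤ 2 * c₁ * n := by linarith
  set A := c * n / r with hA
  have hlA : l ≤ A := by
    rw [hA, le_div_iff₀ hr0, mul_comm]
    calc r * l ≤ 2 * c₁ * n := hrl
      _ ≤ 2 * (c / 2) * n := by gcongr
      _ = c * n := by ring
  have hAc : A ≤ c * n := div_le_self (by positivity) hr1
  set m₀ := ⌊A / l⌋₊ with hm₀
  have hAl : 1 ≤ A / l := by rw [le_div_iff₀ hl0]; linarith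
  have hm1 : 1 ≤ m₀ := Nat.one_le_floor_iff _ |>.2 hAl
  have hm1' : (1 : ℝ) ≤ m₀ := by exact_mod_cast hm1
  have hmA : m₀ * l ≤ A := by
    rw [← le_div_iff₀ hl0]
    exact Nat.floor_le (by positivity)
  have hAm : A ≤ 2 * (m₀ * l) := by
    have h1 : A / l < m₀ + 1 := Nat.lt_floor_add_one _
    rw [div_lt_iff₀ hl0] at h1
    have h2 : ((m₀ : ℝ) + 1) * l ≤ 2 * m₀ * l := mul_le_mul_of_nonneg_right (by linarith) hl0.le
    linarith
  have hcardV := card_le_of_isAdmissibleLevel hr hrn hV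
  rw [← hl] at hcardV
  have hcard : V.card ≤ (2 * n) ^ (m₀ * 2 ^ Nat.clog 2 (40 * n)) := by
    have h1 : (40 * n : ℝ) ≤ 2 ^ Nat.clog 2 (40 * n) := by
      exact_mod_cast Nat.le_pow_clog (by norm_num) _
    have h2 : (V.card : ℝ) ≤ (2 * n) ^ (m₀ * 2 ^ Nat.clog 2 (40 * n)) := by
      refine hcardV.trans ?_
      have e : Real.exp ((m₀ * 2 ^ Nat.clog 2 (40 * n) : ℕ) * l)
          = (2 * n) ^ (m₀ * 2 ^ Nat.clog 2 (40 * n)) := by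
        rw [Real.exp_nat_mul, hl, Real.exp_log (by positivity)]
      rw [← e]
      apply Real.exp_le_exp.2
      push_cast
      refine mul_le_mul_of_nonneg_right ?_ hl0.le
      calc (40 * r : ℝ) ≤ 1 * (40 * n) := by linarith
        _ ≤ m₀ * 2 ^ Nat.clog 2 (40 * n) := mul_le_mul hm1' h1 (by positivity) (by positivity)
    exact_mod_cast h2
  have hcard' : V.card * Real.exp (-(a ^ 2 / (128 * β ^ 2) * n)) ≤ Real.exp (-A) := by
    calc V.card * Real.exp (-(a ^ 2 / (128 * β ^ 2) * n))
        ≤ Real.exp (40 * r * l) * Real.exp (-(c' * n)) := by gcongr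
      _ = Real.exp (40 * r * l - c' * n) := by rw [← Real.exp_add]; ring_nf
      _ ≤ Real.exp (-A) := by
        apply Real.exp_le_exp.2
        have h1 : 40 * r * l ≤ c' / 2 * n := by
          calc 40 * r * l = 40 * (r * l) := by ring
            _ ≤ 40 * (2 * c₁ * n) := mul_le_mul_of_nonneg_left hrl (by norm_num)
            _ ≤ 40 * (2 * (c' / 160) * n) := by gcongr
            _ = c' / 2 * n := by ring
        have h2 : A ≤ c' / 2 * n := hAc.trans (by gcongr)
        linarith
  have hchain : (β * √((r : ℝ) / n) * √(2 * A)
        + Nat.clog 2 (40 * n) * (72 * (β * √((r : ℝ) / n)) * Real.log (4 * n))) * D ≤ 1 :=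
    chain_size_mul_le_one hr hn3 hβ0 hD0 hcC hc₁C hnr hA
  exact h.measureReal_exists_weightedForm_lt_le hL hβ0 hr (by omega) hW hO hV.1 hm1 hmA hAm
    (hAc.trans (by nlinarith)) hcard hcard' hchain

lemma one_sub_le_measureReal {𝕜 : Type w} [RCLike 𝕜] {L β κ₁ κ₂ : ℝ} (hL : 1 ≤ L) (hβ : 1 ≤ β)
    (hκ : IsSmallBallPair.{u, w} 𝕜 L β κ₁ κ₂) :
    ∃ c₁ c₂ : ℝ, 0 < c₁ ∧ 0 < c₂ ∧
      ∀ (n r : ℕ), 1 ≤ r → r ≤ n → (r : ℝ) * Real.log n ^ 4 ≤ c₁ * n →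
      ∀ (U W O : Matrix (Fin n) (Fin n) 𝕜),
        IsHadamardType β U → IsHadamardType β W → IsHadamardType β O →
      ∀ (Ω : Type u) [MeasurableSpace Ω] (μ : Measure Ω) [IsProbabilityMeasure μ]
        (ξ : Fin n → Ω → ℝ), IsSubgaussianGenerator μ L ξ →
      ∀ V : Finset (EuclideanSpace ℝ (Fin n)),
        IsAdmissibleLevel (sparseSphere n r) (sOne n r) V →
        1 - 2 * Real.exp (-(c₂ * n / r)) ≤
          μ.real {ω | ∀ v ∈ V,
            κ₁ / 2 * √(n : ℝ) ≤ normMulVec (gammaMatrix U W O v) (fun i => ξ i ω)} := by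
  have hκ1 := hκ.1
  have hκ2 := hκ.2.1
  obtain ⟨c, c₁, hc0, hc₁0, hmain⟩ :=
    exists_measureReal_exists_weightedForm_lt_le.{u, w} 𝕜 hL hβ
  set T := max 3 (max (1 / κ₂) (3 / c)) with hT
  have hT3 : 3 ≤ T := le_max_left _ _
  have hTκ : 1 / κ₂ ≤ T := (le_max_left _ _).trans (le_max_right _ _)
  have hTc : 3 / c ≤ T := (le_max_right _ _).trans (le_max_right _ _)
  have hlog2 := Real.log_pos (by norm_num : (1 : ℝ) < 2)
  have hT0 : 0 < T := by linarith
  refine ⟨c₁, min (c / 2) (Real.log 2 / T), hc₁0, lt_min (by positivity) (by positivity), ?_⟩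
  intro n r hr hrn hnr U W O hU hW hO Ω _ μ _ ξ h V hV
  set c₂ := min (c / 2) (Real.log 2 / T) with hc₂
  have hr0 : (0 : ℝ) < r := by exact_mod_cast hr
  have hr1 : (1 : ℝ) ≤ r := by exact_mod_cast hr
  have hrn' : (r : ℝ) ≤ n := by exact_mod_cast hrn
  have hn0 : (0 : ℝ) < n := hr0.trans_le hrn'
  have hx0 : 0 < (n : ℝ) / r := by positivity
  rcases le_or_gt ((n : ℝ) / r) T with hsmall | hlarge
  · -- for bounded `n / r` the claimed probability is at most zero
    have h1 : c₂ * n / r ≤ Real.log 2 := by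
      rw [mul_div_assoc]
      calc c₂ * (n / r) ≤ Real.log 2 / T * T := by
            gcongr
            exact min_le_right _ _
        _ = Real.log 2 := by field_simp
    have h2 : 1 / 2 ≤ Real.exp (-(c₂ * n / r)) := by
      calc (1 : ℝ) / 2 = Real.exp (-Real.log 2) := by
            rw [Real.exp_neg, Real.exp_log (by norm_num), one_div]
        _ ≤ _ := Real.exp_le_exp.2 (by linarith)
    exact le_trans (by linarith) measureReal_nonneg
  rcases V.eq_empty_or_nonempty with rfl | ⟨v₀, hv₀⟩
  · simp [(Real.exp_pos _).le]
  have hsq : κ₁ ^ 2 ≤ 5 / 2 := by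
    refine hκ.sq_le hL hr hrn ?_ hU hW hO h (hV.1 hv₀)
    rw [mul_div_assoc]
    calc (1 : ℝ) = κ₂ * (1 / κ₂) := by field_simp
      _ ≤ κ₂ * (n / r) := mul_le_mul_of_nonneg_left (hTκ.trans hlarge.le) hκ2.le
  have hn3' : (3 : ℝ) ≤ n := by
    have : (n : ℝ) / r ≤ n := div_le_self hn0.le hr1
    linarith
  have hn3 : 3 ≤ n := by exact_mod_cast hn3'
  set A := c * n / r with hA
  have hA3 : 3 ≤ A := by
    rw [hA, mul_div_assoc]
    calc (3 : ℝ) = c * (3 / c) := by field_simp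
      _ ≤ c * (n / r) := mul_le_mul_of_nonneg_left (hTc.trans hlarge.le) hc0.le
  have key := hmain n r hr hrn hn3 hnr W O hW hO Ω μ ξ h V hV
  rw [← hA] at key
  set E : Set Ω := {ω | ∃ v ∈ V, weightedForm O (transformWeight W v) (fun i => ξ i ω) < 5 / 8}
    with hE
  have hsub : (Set.univ : Set Ω) ⊆ {ω | ∀ v ∈ V,
      κ₁ / 2 * √(n : ℝ) ≤ normMulVec (gammaMatrix U W O v) (fun i => ξ i ω)} ∪ E := by
    intro ω _
    by_cases hω : ω ∈ E
    · exact Or.inr hω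
    · left
      intro v hv
      have h1 : 5 / 8 ≤ weightedForm O (transformWeight W v) (fun i => ξ i ω) := by
        by_contra hlt
        exact hω ⟨v, hv, not_le.1 hlt⟩
      rw [normMulVec_gammaMatrix hU.1, mul_comm]
      gcongr
      apply Real.le_sqrt_of_sq_le
      linarith [div_pow κ₁ 2 2]
  have h4 := measureReal_mono (μ := μ) hsub
  rw [probReal_univ] at h4
  have h5 := h4.trans (measureReal_union_le _ _)
  have h6 : 6 * Real.exp (-A) ≤ 2 * Real.exp (-(c₂ * n / r)) := by
    have e1 : c₂ * n / r ≤ A / 2 := by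
      calc c₂ * n / r ≤ c / 2 * n / r := by gcongr; exact min_le_left _ _
        _ = A / 2 := by rw [hA]; ring
    have e2 : Real.exp (-A) = Real.exp (-(A / 2)) * Real.exp (-(A / 2)) := by
      rw [← Real.exp_add]; congr 1; ring
    have e3 : Real.exp (-(A / 2)) ≤ 1 / 3 := by
      have h3 : 3 ≤ Real.exp (A / 2) := by
        have := Real.quadratic_le_exp_of_nonneg (by linarith : 0 ≤ A / 2)
        nlinarith
      rw [Real.exp_neg, one_div]
      exact inv_anti₀ (by norm_num) h3
    calc 6 * Real.exp (-A) = 6 * (Real.exp (-(A / 2)) * Real.exp (-(A / 2))) := by rw [e2]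
      _ ≤ 6 * (Real.exp (-(A / 2)) * (1 / 3)) := by gcongr
      _ = 2 * Real.exp (-(A / 2)) := by ring
      _ ≤ _ := by gcongr
  linarith

end Assembly

theorem mainTheorem5 (𝕜 : Type w) [RCLike 𝕜] (L β : ℝ) (hL : 1 ≤ L) (hβ : 1 ≤ β) :
    (∃ κ₁ κ₂ : ℝ, IsSmallBallPair.{u, w} 𝕜 L β κ₁ κ₂) ∧
    ∀ κ₁ κ₂ : ℝ, IsSmallBallPair.{u, w} 𝕜 L β κ₁ κ₂ →
      ∃ c₁ c₂ : ℝ, 0 < c₁ ∧ 0 < c₂ ∧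
        ∀ (n r : ℕ), 1 ≤ r → r ≤ n → (r : ℝ) * Real.log n ^ 4 ≤ c₁ * n →
        ∀ (U W O : Matrix (Fin n) (Fin n) 𝕜),
          IsHadamardType β U → IsHadamardType β W → IsHadamardType β O →
        ∀ (Ω : Type u) [MeasurableSpace Ω] (μ : Measure Ω) [IsProbabilityMeasure μ]
          (ξ : Fin n → Ω → ℝ), IsSubgaussianGenerator μ L ξ →
        ∀ V : Finset (EuclideanSpace ℝ (Fin n)),
          IsAdmissibleLevel (sparseSphere n r) (sOne n r) V →
          1 - 2 * Real.exp (-(c₂ * n / r)) ≤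
            μ.real {ω | ∀ v ∈ V,
              κ₁ / 2 * √(n : ℝ) ≤
                normMulVec (gammaMatrix U W O v) (fun i => ξ i ω)} := 
  ⟨exists_isSmallBallPair.{u, w} 𝕜 hL hβ, fun _ _ hκ => one_sub_le_measureReal hL hβ hκ⟩
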